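/- Let $\Bbbk$ be an algebraically closed field of characteristic zero and let $q\in\Bbbk^*=\Bbbk\setminus\{0\}$ be not a root of unity. Let $D_q$ be the Heisenberg double of the quantum Euclidean group, i.e. the (unital, associative) $\Bbbk$-algebra generated by $a,a^{-1},b,c,K,K^{-1},E,F$ subject to the defining relations $$ab=qba,\quad ac=qca,\quad bc=cb,\quad aa^{-1}=a^{-1}a=1,$$ $$KE=q^2EK,\quad KF=q^{-2}FK,\quad EF=FE,\quad KK^{-1}=K^{-1}K=1,$$ $$Ka=q^{-1}aK,\quad Kb=qbK,\quad Kc=q^{-1}cK,\quad Ea=aE,\quad Eb=bE,\quad Ec=cE+a^{-1}K,$$ $$Fa=qaF,\quad Fb=q^{-1}bF+a,\quad Fc=qcF.$$ Put $\phi=(1-q^2)Fb+q^2a$ and $\psi=(1-q^{-2})Ec+q^{-2}a^{-1}K$, and write $\mathrm{Aut}\,D_q$ for the group of $\Bbbk$-algebra automorphisms of $D_q$. (1) For all $t=(\lambda,\mu,\gamma,\nu)\in(\Bbbk^*)^4$ and all $M=\begin{pmatrix} i&j\\ m&n\end{pmatrix}\in\mathrm{SL}_2(\mathbb Z)$ there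 is a unique automorphism $\rho_{t,M}=\rho_{\lambda,\mu,\gamma,\nu,i,j,m,n}$ of $D_q$ such that $$K\mapsto\lambda K^ia^j,\qquad a\mapsto\mu K^ma^n,\qquad F\mapsto\gamma K^{-i+2m+1}a^{-j+2n-2}F,$$ $$b\mapsto\mu\gamma^{-1}q^{ij+2mn-3in-2j+3n}K^{i-m-1}a^{j-n+1}b,$$ $$E\mapsto\nu K^{-2m}a^{-2n+2}E,\qquad c\mapsto\lambda\mu^{-1}\nu^{-1}q^{in+3mn-j-n}K^{i+m-1}a^{j+n-1}c.$$ (2) Every $\rho\in\mathrm{Aut}\,D_q$ equals $\rho_{t,M}$ for exactly one pair $(t,M)\in(\Bbbk^*)^4\times\mathrm{SL}_2(\mathbb Z)$. (3) $\mathrm{Aut}\,D_q\cong(\Bbbk^*)^4\rtimes\mathrm{SL}_2(\mathbb Z)$: for some action of $\mathrm{SL}_2(\mathbb Z)$ on $(\Bbbk^*)^4$ by group automorphisms there is a group isomorphism $e:(\Bbbk^*)^4\rtimes\mathrm{SL}_2(\mathbb Z)\to\mathrm{Aut}\,D_q$ such that $e(t,1)=\rho_{t,1}$ for all $t\in(\Bbbk^*)^4$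 and, for each $(t,g)$, $e(t,g)=\rho_{t',g^{\mathsf T}}$ for some $t'\in(\Bbbk^*)^4$. (4) The height one prime ideals of $D_q$ are precisely the two-sided ideals $(\phi)$ and $(\psi)$, and no automorphism $\rho$ of $D_q$ interchanges them, i.e. satisfies both $\rho((\phi))=(\psi)$ and $\rho((\psi))=(\phi)$. -/

import Mathlib

open scoped MatrixGroups

namespace HeisenbergDouble

/-- Names of the generators `a, a⁻¹, b, c, K, K⁻¹, E, F`. -/
inductive Gen : Type
  | a | aInv | b | c | K | KInv | E | F

section Presentation

variable (k : Type*) [Field k] (q : kˣ)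

/-- The generator with name `g` in the free algebra. -/
abbrev gen (g : Gen) : FreeAlgebra k Gen := FreeAlgebra.ι k g

open Gen in
/-- The defining relations of the Heisenberg double of the quantum Euclidean group. -/
inductive Rel : FreeAlgebra k Gen → FreeAlgebra k Gen → Prop
  | a_b : Rel (gen k a * gen k b) ((q : k) • (gen k b * gen k a))
  | a_c : Rel (gen k a * gen k c) ((q : k) • (gen k c * gen k a))
  | b_c : Rel (gen k b * gen k c) (gen k c * gen k b)
  | a_aInv : Rel (gen k a * gen k aInv) 1
  | aInv_a : Rel (gen k aInv * gen k a) 1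
  | K_E : Rel (gen k K * gen k E) ((q : k) ^ 2 • (gen k E * gen k K))
  | K_F : Rel (gen k K * gen k F) ((q : k) ^ (-2 : ℤ) • (gen k F * gen k K))
  | E_F : Rel (gen k E * gen k F) (gen k F * gen k E)
  | K_KInv : Rel (gen k K * gen k KInv) 1
  | KInv_K : Rel (gen k KInv * gen k K) 1
  | K_a : Rel (gen k K * gen k a) ((q : k)⁻¹ • (gen k a * gen k K))
  | K_b : Rel (gen k K * gen k b) ((q : k) • (gen k b * gen k K))
  | K_c : Rel (gen k K * gen k c) ((q : k)⁻¹ • (gen k c * gen k K))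
  | E_a : Rel (gen k E * gen k a) (gen k a * gen k E)
  | E_b : Rel (gen k E * gen k b) (gen k b * gen k E)
  | E_c : Rel (gen k E * gen k c) (gen k c * gen k E + gen k aInv * gen k K)
  | F_a : Rel (gen k F * gen k a) ((q : k) • (gen k a * gen k F))
  | F_b : Rel (gen k F * gen k b) ((q : k)⁻¹ • (gen k b * gen k F) + gen k a)
  | F_c : Rel (gen k F * gen k c) ((q : k) • (gen k c * gen k F))

/-- The Heisenberg double `D_q`: the `k`-algebra given by the generators `Gen` and the
relations `Rel`. -/
abbrev D : Type _ := RingQuot (Rel k q)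

/-- The image in `D_q` of a generator. -/
noncomputable def x (g : Gen) : D k q := RingQuot.mkAlgHom k (Rel k q) (gen k g)

/-- `a` as a unit of `D_q`. -/
noncomputable def aUnit : (D k q)ˣ where
  val := x k q Gen.a
  inv := x k q Gen.aInv
  val_inv := by
    simpa [x] using RingQuot.mkAlgHom_rel k (Rel.a_aInv (k := k) (q := q))
  inv_val := by
    simpa [x] using RingQuot.mkAlgHom_rel k (Rel.aInv_a (k := k) (q := q))

/-- `K` as a unit of `D_q`. -/
noncomputable def KUnit : (D k q)ˣ where
  val := x k q Gen.K
  inv := x k q Gen.KInv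
  val_inv := by
    simpa [x] using RingQuot.mkAlgHom_rel k (Rel.K_KInv (k := k) (q := q))
  inv_val := by
    simpa [x] using RingQuot.mkAlgHom_rel k (Rel.KInv_K (k := k) (q := q))

/-- The element `K^r a^s` of `D_q`, for integers `r` and `s`. -/
noncomputable def KA (r s : ℤ) : D k q := ((KUnit k q ^ r * aUnit k q ^ s : (D k q)ˣ) : D k q)

/-- `φ = (1 - q²) F b + q² a`. -/
noncomputable def phi : D k q :=
  (1 - (q : k) ^ 2) • (x k q Gen.F * x k q Gen.b) + (q : k) ^ 2 • x k q Gen.a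

/-- `ψ = (1 - q⁻²) E c + q⁻² a⁻¹ K`. -/
noncomputable def psi : D k q :=
  (1 - (q : k) ^ (-2 : ℤ)) • (x k q Gen.E * x k q Gen.c) +
    (q : k) ^ (-2 : ℤ) • (x k q Gen.aInv * x k q Gen.K)

/-- The group `(k*)⁴`; its elements are the quadruples `(lam, mu, ga, nu)`. -/
abbrev Torus : Type _ := kˣ × kˣ × kˣ × kˣ

variable {k q}

/-- The algebra automorphism `ρ` is `ρ_{λ,μ,γ,ν,i,j,m,n}`, where `t = (λ, μ, γ, ν)` and
`M = (i j; m n)`. -/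
def IsRho (ρ : D k q ≃ₐ[k] D k q) (t : Torus k) (M : SL(2, ℤ)) : Prop :=
  let lam := t.1
  let mu := t.2.1
  let ga := t.2.2.1
  let nu := t.2.2.2
  let i := M.1 0 0
  let j := M.1 0 1
  let m := M.1 1 0
  let n := M.1 1 1
  ρ (x k q Gen.K) = (lam : k) • KA k q i j ∧
  ρ (x k q Gen.a) = (mu : k) • KA k q m n ∧
  ρ (x k q Gen.F) =
    (ga : k) • (KA k q (-i + 2 * m + 1) (-j + 2 * n - 2) * x k q Gen.F) ∧
  ρ (x k q Gen.b) =
    ((mu * ga⁻¹ * q ^ (i * j + 2 * m * n - 3 * i * n - 2 * j + 3 * n) : kˣ) : k) •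
      (KA k q (i - m - 1) (j - n + 1) * x k q Gen.b) ∧
  ρ (x k q Gen.E) = (nu : k) • (KA k q (-2 * m) (-2 * n + 2) * x k q Gen.E) ∧
  ρ (x k q Gen.c) =
    ((lam * mu⁻¹ * nu⁻¹ * q ^ (i * n + 3 * m * n - j - n) : kˣ) : k) •
      (KA k q (i + m - 1) (j + n - 1) * x k q Gen.c)

end Presentation

section Primes

variable {R : Type*} [Ring R]

/-- Prime (two-sided) ideals of a not necessarily commutative ring, in the elementwise form:
`P` is proper, and `x R y ⊆ P` implies `x ∈ P` or `y ∈ P`. -/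
def IsPrimeIdeal (P : TwoSidedIdeal R) : Prop :=
  P ≠ ⊤ ∧ ∀ x y : R, (∀ r : R, x * r * y ∈ P) → x ∈ P ∨ y ∈ P

variable (R) in
/-- The prime spectrum of `R`, ordered by inclusion. -/
abbrev PrimeSpec : Type _ := {P : TwoSidedIdeal R // IsPrimeIdeal P}

/-- `P` is a prime ideal of height one. -/
def IsHeightOnePrime (P : TwoSidedIdeal R) : Prop :=
  ∃ hP : IsPrimeIdeal P, Order.height (⟨P, hP⟩ : PrimeSpec R) = 1

end Primes

end HeisenbergDouble

/-!
Choose a square root `s` of `q`. After multiplication by suitable monomials in `K` and `a`, the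
generators `b`, `F`, `c`, `E` become elements `b`, `f`, `c`, `e` that commute with `K` and `a`, and
`b`, `f` commute with `c`, `e` up to powers of `q`: thus `D_q` splits into a quantum torus in `K`,
`a`, an algebra generated by `b` and `f`, and one generated by `c` and `e`. The elements `1 - b f`
and `1 - c e` are normal, and they are `φ` and `ψ` up to units. In this form `SL₂(ℤ)` acts by
symplectic substitutions in the torus and `(k*)⁴` by rescaling.

Since `f` and `e` can be solved for once `b` and `c` are inverted, `D_q` embeds in the quantum torus
generated by `φ`, `ψ`, `b`, `c`, `K` and `a`. Commuting with its elements strips a nonzero ideal of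
`D_q` down to a monomial in these, and commuting with `f` and `e` then lowers the powers of `b` and
`c`, which leaves a product of powers of `φ` and `ψ`. Hence a nonzero prime contains `φ` or `ψ`.

The units of `D_q` are the monomials in `K` and `a`, up to scalars, so every automorphism acts on
them through `SL₂(ℤ)`. An automorphism that fixes `K` and `a` permutes the height one primes `(φ)`
and `(ψ)`, hence the elements `1 - b f` and `1 - c e` up to scalars. The commutation with these
determines the bidegrees of the images of `b`, `f`, `c`, `e`, and comparing leading exponents in the
quantum torus shows that no interchange occurs and that `b`, `f`, `c`, `e` are only rescaled.
-/

/-- The twisted group algebra of `G` over `k`: it has the basis `e_g` for `g` in `G`, with the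
products `e_g e_h = s ^ ω(g, h) e_{g+h}`. For `G` free of finite rank this is a quantum torus. -/
def TwistedAlg {k G : Type*} [Field k] [AddCommGroup G] (_s : kˣ) (_ω : G →+ G →+ ℤ) : Type _ :=
  G →₀ k

namespace TwistedAlg

variable {k G : Type*} [Field k] [AddCommGroup G] {s : kˣ} {ω : G →+ G →+ ℤ}

noncomputable instance : AddCommGroup (TwistedAlg s ω) := inferInstanceAs (AddCommGroup (G →₀ k))
noncomputable instance : Module k (TwistedAlg s ω) := inferInstanceAs (Module k (G →₀ k))

variable (s ω) in
/-- The basis of the elements `e_g`. -/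
noncomputable def basis : Module.Basis G k (TwistedAlg s ω) :=
  Module.Basis.ofRepr (LinearEquiv.refl k (G →₀ k))

/-- The coefficient of an element at `e_g`. -/
noncomputable def coeff (g : G) : TwistedAlg s ω →ₗ[k] k := (basis s ω).coord g

/-- The element `r e_g`. -/
noncomputable def single (g : G) (r : k) : TwistedAlg s ω := r • basis s ω g

/-- The set of exponents `g` at which the coefficient of `y` does not vanish. -/
noncomputable def support (y : TwistedAlg s ω) : Finset G := ((basis s ω).repr y).support

lemma mem_support {y : TwistedAlg s ω} {g : G} : g ∈ y.support ↔ coeff g y ≠ 0 :=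
  Finsupp.mem_support_iff

@[ext]
lemma ext {y z : TwistedAlg s ω} (h : ∀ g, coeff g y = coeff g z) : y = z :=
  (basis s ω).ext_elem h

lemma sum_single (y : TwistedAlg s ω) : ∑ g ∈ y.support, single g (coeff g y) = y :=
  (basis s ω).linearCombination_repr y

lemma support_nonempty {y : TwistedAlg s ω} (hy : y ≠ 0) : y.support.Nonempty := by
  contrapose! hy
  rw [← sum_single y, hy, Finset.sum_empty]

lemma coeff_single [DecidableEq G] (g h : G) (r : k) :
    coeff h (single (s := s) (ω := ω) g r) = if g = h then r else 0 := by
  simp [coeff, single, Finsupp.single_apply]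

@[simp]
lemma coeff_single_self (g : G) (r : k) : coeff g (single (s := s) (ω := ω) g r) = r := by
  classical simp [coeff_single]

lemma eq_of_coeff_single_ne_zero {g h : G} {r : k}
    (hne : coeff h (single (s := s) (ω := ω) g r) ≠ 0) : h = g := by
  classical
  rw [coeff_single] at hne
  exact (ite_ne_right_iff.1 hne).1.symm

lemma eq_single_of_forall_coeff {y : TwistedAlg s ω} {g : G} (hy : ∀ h, coeff h y ≠ 0 → h = g) :
    y = single g (coeff g y) := by
  classical
  ext u
  rw [coeff_single]
  split_ifs with hu
  · rw [hu]
  · by_contra hc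
    exact hu (hy u hc).symm

lemma induction_single {p : TwistedAlg s ω → Prop} (y : TwistedAlg s ω) (zero : p 0)
    (add : ∀ y z, p y → p z → p (y + z)) (single : ∀ g r, p (single g r)) : p y := by
  rw [← sum_single y]
  exact Finset.sum_induction _ p add zero fun g _ ↦ single g _

/-- The product of the twisted group algebra as a bilinear map. -/
noncomputable def mulLin : TwistedAlg s ω →ₗ[k] TwistedAlg s ω →ₗ[k] TwistedAlg s ω :=
  (basis s ω).constr k fun g ↦ (basis s ω).constr k fun h ↦ (s : k) ^ ω g h • basis s ω (g + h)

noncomputable instance : Mul (TwistedAlg s ω) := ⟨fun y z ↦ mulLin y z⟩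
noncomputable instance : One (TwistedAlg s ω) := ⟨single 0 1⟩

lemma mul_def (y z : TwistedAlg s ω) : y * z = mulLin y z := rfl
lemma one_def : (1 : TwistedAlg s ω) = single 0 1 := rfl

lemma single_mul_single (g h : G) (r t : k) :
    single (s := s) (ω := ω) g r * single h t = single (g + h) ((s : k) ^ ω g h * r * t) := by
  simp only [mul_def, single, mulLin, map_smul, LinearMap.smul_apply, Module.Basis.constr_basis,
    smul_smul]
  congr 1
  ring

noncomputable instance : NonUnitalNonAssocRing (TwistedAlg s ω) where
  left_distrib y z w := by simp only [mul_def, map_add]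
  right_distrib y z w := by simp only [mul_def, map_add, LinearMap.add_apply]
  zero_mul y := by simp only [mul_def, map_zero, LinearMap.zero_apply]
  mul_zero y := by simp only [mul_def, map_zero]

noncomputable instance : Ring (TwistedAlg s ω) where
  __ := (inferInstance : NonUnitalNonAssocRing (TwistedAlg s ω))
  mul_assoc y z w := by
    induction y using induction_single with
    | zero => simp only [zero_mul]
    | add y y' hy hy' => simp only [add_mul, hy, hy']
    | single g r =>
    induction z using induction_single with
    | zero => simp only [zero_mul, mul_zero]
    | add z z' hz hz' => simp only [add_mul, mul_add, hz, hz']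
    | single h t =>
    induction w using induction_single with
    | zero => simp only [mul_zero]
    | add w w' hw hw' => simp only [mul_add, hw, hw']
    | single l v =>
    simp only [single_mul_single, map_add, AddMonoidHom.add_apply, zpow_add₀ s.ne_zero, add_assoc]
    congr 1
    ring
  one_mul y := by
    induction y using induction_single with
    | zero => exact mul_zero _
    | add y y' hy hy' => rw [mul_add, hy, hy']
    | single g r => simp [one_def, single_mul_single]
  mul_one y := by
    induction y using induction_single with
    | zero => exact zero_mul _
    | add y y' hy hy' => rw [add_mul, hy, hy']
    | single g r => simp [one_def, single_mul_single]

noncomputable instance : Algebra k (TwistedAlg s ω) :=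
  Algebra.ofModule (fun r y z ↦ by simp [mul_def]) (fun r y z ↦ by simp [mul_def])

lemma coeff_mul [DecidableEq G] (y z : TwistedAlg s ω) (u : G) :
    coeff u (y * z) = ∑ g ∈ y.support, ∑ h ∈ z.support,
      if g + h = u then (s : k) ^ ω g h * coeff g y * coeff h z else 0 := by
  conv_lhs => rw [← sum_single y, ← sum_single z]
  simp only [Finset.sum_mul, Finset.mul_sum, map_sum, single_mul_single, coeff_single]
  rw [Finset.sum_comm]

lemma exists_of_coeff_mul_ne_zero {y z : TwistedAlg s ω} {u : G} (hu : coeff u (y * z) ≠ 0) :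
    ∃ g h, g + h = u ∧ coeff g y ≠ 0 ∧ coeff h z ≠ 0 := by
  classical
  rw [coeff_mul] at hu
  obtain ⟨g, hg, hu⟩ := Finset.exists_ne_zero_of_sum_ne_zero hu
  obtain ⟨h, hh, hu⟩ := Finset.exists_ne_zero_of_sum_ne_zero hu
  exact ⟨g, h, (ite_ne_right_iff.1 hu).1, mem_support.1 hg, mem_support.1 hh⟩

lemma coeff_mul_of_uniqueAdd {y z : TwistedAlg s ω} {g h : G}
    (huniq : UniqueAdd y.support z.support g h) :
    coeff (g + h) (y * z) = (s : k) ^ ω g h * coeff g y * coeff h z := by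
  classical
  rw [coeff_mul, Finset.sum_eq_single g, Finset.sum_eq_single h, if_pos rfl]
  · exact fun h' _ hne ↦ if_neg fun he ↦ hne (add_left_cancel he)
  · intro hh
    simp [not_not.1 (mt mem_support.2 hh)]
  · exact fun g' hg' hne ↦ Finset.sum_eq_zero fun h' hh' ↦ if_neg fun he ↦
      hne (huniq hg' hh' he).1
  · intro hg
    simp [not_not.1 (mt mem_support.2 hg)]

lemma coeff_single_mul (g h : G) (r : k) (y : TwistedAlg s ω) :
    coeff (g + h) (single g r * y) = (s : k) ^ ω g h * r * coeff h y := by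
  rw [coeff_mul_of_uniqueAdd, coeff_single_self]
  intro g' h' hg' _ he
  obtain rfl := eq_of_coeff_single_ne_zero (mem_support.1 hg')
  exact ⟨rfl, add_left_cancel he⟩

lemma coeff_mul_single (g h : G) (r : k) (y : TwistedAlg s ω) :
    coeff (g + h) (y * single h r) = (s : k) ^ ω g h * coeff g y * r := by
  rw [coeff_mul_of_uniqueAdd, coeff_single_self]
  intro g' h' _ hh' he
  obtain rfl := eq_of_coeff_single_ne_zero (mem_support.1 hh')
  exact ⟨add_right_cancel he, rfl⟩

/-- `y` is a nonzero multiple of the basis element `e_g`. -/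
def IsMonomial (y : TwistedAlg s ω) (g : G) : Prop := ∃ r : k, r ≠ 0 ∧ y = single g r

lemma isMonomial_single (g : G) {r : k} (hr : r ≠ 0) :
    IsMonomial (single (s := s) (ω := ω) g r) g := ⟨r, hr, rfl⟩

lemma isMonomial_one : IsMonomial (1 : TwistedAlg s ω) 0 := isMonomial_single 0 one_ne_zero

lemma IsMonomial.smul {y : TwistedAlg s ω} {g : G} (hy : IsMonomial y g) {r : k} (hr : r ≠ 0) :
    IsMonomial (r • y) g := by
  obtain ⟨t, ht, rfl⟩ := hy
  exact ⟨r * t, mul_ne_zero hr ht, smul_smul r t _⟩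

lemma IsMonomial.mul {y z : TwistedAlg s ω} {g h : G} (hy : IsMonomial y g)
    (hz : IsMonomial z h) : IsMonomial (y * z) (g + h) := by
  obtain ⟨r, hr, rfl⟩ := hy
  obtain ⟨t, ht, rfl⟩ := hz
  rw [single_mul_single]
  exact isMonomial_single _ (mul_ne_zero (mul_ne_zero (zpow_ne_zero _ s.ne_zero) hr) ht)

lemma IsMonomial.pow {y : TwistedAlg s ω} {g : G} (hy : IsMonomial y g) (n : ℕ) :
    IsMonomial (y ^ n) (n • g) := by
  induction n with
  | zero => simpa only [pow_zero, zero_nsmul] using isMonomial_one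
  | succ n ih => rw [pow_succ, succ_nsmul]; exact ih.mul hy

lemma IsMonomial.exists_eq_smul {y z : TwistedAlg s ω} {g : G} (hy : IsMonomial y g)
    (hz : IsMonomial z g) : ∃ r : k, r ≠ 0 ∧ y = r • z := by
  obtain ⟨r, hr, rfl⟩ := hy
  obtain ⟨t, ht, rfl⟩ := hz
  exact ⟨r / t, div_ne_zero hr ht, by rw [single, single, smul_smul, div_mul_cancel₀ r ht]⟩

lemma coeff_mul_sub_smul_mul_ne_zero_iff {y z : TwistedAlg s ω} {u w : G} (hz : IsMonomial z u)
    {c : k} : coeff (w + u) (y * z - c • (z * y)) ≠ 0 ↔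
      (s : k) ^ (ω w u - ω u w) ≠ c ∧ coeff w y ≠ 0 := by
  obtain ⟨r, hr, rfl⟩ := hz
  have hcoeff : coeff (w + u) (y * single u r - c • (single u r * y)) =
      ((s : k) ^ ω w u - c * (s : k) ^ ω u w) * r * coeff w y := by
    rw [map_sub, map_smul, coeff_mul_single, add_comm w u, coeff_single_mul, smul_eq_mul]
    ring
  rw [hcoeff, mul_ne_zero_iff, mul_ne_zero_iff, and_iff_left hr, sub_ne_zero,
    zpow_sub₀ s.ne_zero, (div_eq_iff (zpow_ne_zero _ s.ne_zero)).ne]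

lemma zpow_eq_of_mul_eq_smul_mul {y z : TwistedAlg s ω} {u v : G} {c : k}
    (h : y * z = c • (z * y)) (hy : coeff v y ≠ 0) (hz : IsMonomial z u) :
    (s : k) ^ (ω v u - ω u v) = c := by
  by_contra hne
  apply (coeff_mul_sub_smul_mul_ne_zero_iff hz).2 ⟨hne, hy⟩
  rw [h, sub_self, map_zero]

lemma card_support_mul_sub_smul_mul_lt {y z : TwistedAlg s ω} {u v : G} (hz : IsMonomial z u)
    (hv : coeff v y ≠ 0) :
    (y * z - (s : k) ^ (ω v u - ω u v) • (z * y)).support.card < y.support.card := by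
  classical
  have hsub : (y * z - (s : k) ^ (ω v u - ω u v) • (z * y)).support ⊆
      (y.support.erase v).map (addRightEmbedding u) := by
    intro w hw
    rw [mem_support, ← sub_add_cancel w u, coeff_mul_sub_smul_mul_ne_zero_iff hz] at hw
    refine Finset.mem_map.2 ⟨w - u, Finset.mem_erase.2 ⟨?_, mem_support.2 hw.2⟩,
      sub_add_cancel w u⟩
    exact fun h ↦ hw.1 (h ▸ rfl)
  refine (Finset.card_le_card hsub).trans_lt ?_
  rw [Finset.card_map]
  exact Finset.card_erase_lt_of_mem (mem_support.2 hv)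

/-- The elements all of whose exponents lie in a given submonoid. -/
def supported (S : AddSubmonoid G) : Subalgebra k (TwistedAlg s ω) where
  carrier := {y | ∀ g, coeff g y ≠ 0 → g ∈ S}
  mul_mem' hy hz g hg := by
    obtain ⟨u, v, rfl, hu, hv⟩ := exists_of_coeff_mul_ne_zero hg
    exact S.add_mem (hy u hu) (hz v hv)
  add_mem' {y z} hy hz g hg := by
    by_cases hyg : coeff g y = 0
    · exact hz g (by rwa [map_add, hyg, zero_add] at hg)
    · exact hy g hyg
  algebraMap_mem' r g hg := by
    rw [Algebra.algebraMap_eq_smul_one, map_smul] at hg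
    exact eq_of_coeff_single_ne_zero (right_ne_zero_of_mul hg) ▸ S.zero_mem

lemma IsMonomial.mem_supported {y : TwistedAlg s ω} {g : G} (hy : IsMonomial y g)
    {S : AddSubmonoid G} (hg : g ∈ S) : y ∈ supported S := by
  obtain ⟨r, -, rfl⟩ := hy
  exact fun h hh ↦ eq_of_coeff_single_ne_zero hh ▸ hg

section UniqueSums

instance [UniqueSums G] : NoZeroDivisors (TwistedAlg s ω) where
  eq_zero_or_eq_zero_of_mul_eq_zero {y z} hyz := by
    by_contra! h
    obtain ⟨g, hg, l, hl, huniq⟩ := UniqueSums.uniqueAdd_of_nonempty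
      (support_nonempty h.1) (support_nonempty h.2)
    have hcoeff := coeff_mul_of_uniqueAdd huniq
    rw [hyz, map_zero] at hcoeff
    exact mul_ne_zero (mul_ne_zero (zpow_ne_zero _ s.ne_zero) (mem_support.1 hg))
      (mem_support.1 hl) hcoeff.symm

lemma exists_isMonomial_of_mul_eq_one [TwoUniqueSums G] {y z : TwistedAlg s ω} (hyz : y * z = 1) :
    ∃ g, IsMonomial y g := by
  have hne : (1 : TwistedAlg s ω) ≠ 0 := fun h ↦ by simpa [one_def] using congrArg (coeff 0) h
  have hy := support_nonempty (left_ne_zero_of_mul (hyz ▸ hne))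
  have hz := support_nonempty (right_ne_zero_of_mul (hyz ▸ hne))
  have add_eq_zero {p : G × G} (hp : p ∈ y.support ×ˢ z.support)
      (huniq : UniqueAdd y.support z.support p.1 p.2) : p.1 + p.2 = 0 := by
    rw [Finset.mem_product] at hp
    refine eq_of_coeff_single_ne_zero (r := 1) (s := s) (ω := ω) ?_
    rw [← one_def, ← hyz, coeff_mul_of_uniqueAdd huniq]
    exact mul_ne_zero (mul_ne_zero (zpow_ne_zero _ s.ne_zero) (mem_support.1 hp.1))
      (mem_support.1 hp.2)
  -- two distinct exponents of the product `1` with a unique representation cannot both be `0`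
  have hcard : y.support.card * z.support.card ≤ 1 := by
    by_contra! hlt
    obtain ⟨p, hp, p', hp', hpp, huniq, huniq'⟩ := TwoUniqueSums.uniqueAdd_of_one_lt_card hlt
    rw [Finset.mem_product] at hp'
    obtain ⟨h₁, h₂⟩ := huniq hp'.1 hp'.2 <|
      (add_eq_zero (Finset.mem_product.2 hp') huniq').trans (add_eq_zero hp huniq).symm
    exact hpp (Prod.ext h₁ h₂).symm
  have hcard' : y.support.card ≤ 1 :=
    (Nat.le_mul_of_pos_right _ (Finset.card_pos.2 hz)).trans hcard
  obtain ⟨g, hg⟩ := hy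
  exact ⟨g, coeff g y, mem_support.1 hg, eq_single_of_forall_coeff fun h hh ↦
    Finset.card_le_one.1 hcard' h (mem_support.2 hh) g hg⟩

end UniqueSums

section Order

variable [LinearOrder G]

/-- `g` is the leading (that is, the largest) exponent of `y`. -/
def HasLead (y : TwistedAlg s ω) (g : G) : Prop :=
  coeff g y ≠ 0 ∧ ∀ h, coeff h y ≠ 0 → h ≤ g

lemma HasLead.ne_zero {y : TwistedAlg s ω} {g : G} (h : HasLead y g) : y ≠ 0 := by
  rintro rfl
  exact h.1 (map_zero _)

lemma HasLead.unique {y : TwistedAlg s ω} {g h : G} (hg : HasLead y g) (hh : HasLead y h) :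
    g = h :=
  le_antisymm (hh.2 g hg.1) (hg.2 h hh.1)

lemma IsMonomial.hasLead {y : TwistedAlg s ω} {g : G} (hy : IsMonomial y g) : HasLead y g := by
  obtain ⟨r, hr, rfl⟩ := hy
  exact ⟨by rwa [coeff_single_self], fun h hh ↦ (eq_of_coeff_single_ne_zero hh).le⟩

lemma HasLead.add_of_lt {y z : TwistedAlg s ω} {g h : G} (hy : HasLead y g) (hz : HasLead z h)
    (hlt : h < g) : HasLead (y + z) g := by
  have hzg : coeff g z = 0 := by
    by_contra hc
    exact (hz.2 _ hc).not_gt hlt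
  refine ⟨by rw [map_add, hzg, add_zero]; exact hy.1, fun u hu ↦ ?_⟩
  by_cases huy : coeff u y = 0
  · rw [map_add, huy, zero_add] at hu
    exact (hz.2 _ hu).trans hlt.le
  · exact hy.2 _ huy

lemma exists_hasLead_linearCombination {ι : Type*} {v : ι → TwistedAlg s ω} {d : ι → G}
    (hd : Function.Injective d) (hv : ∀ i, HasLead (v i) (d i)) {c : ι →₀ k} (hc : c ≠ 0) :
    ∃ i, HasLead (Finsupp.linearCombination k v c) (d i) := by
  obtain ⟨i, hi, hmax⟩ := Finset.exists_max_image c.support d (Finsupp.support_nonempty_iff.2 hc)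
  have hcoeff (h : G) : coeff h (Finsupp.linearCombination k v c) =
      ∑ j ∈ c.support, c j * coeff h (v j) := by
    simp only [Finsupp.linearCombination_apply, Finsupp.sum, map_sum, map_smul, smul_eq_mul]
  refine ⟨i, ?_, fun h hh ↦ ?_⟩
  · rw [hcoeff, Finset.sum_eq_single i]
    · exact mul_ne_zero (Finsupp.mem_support_iff.1 hi) (hv i).1
    · intro j hj hji
      by_contra hne
      exact hji (hd (le_antisymm (hmax j hj) ((hv j).2 _ (right_ne_zero_of_mul hne))))
    · exact fun h ↦ (h hi).elim
  · rw [hcoeff] at hh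
    obtain ⟨j, hj, hne⟩ := Finset.exists_ne_zero_of_sum_ne_zero hh
    exact ((hv j).2 _ (right_ne_zero_of_mul hne)).trans (hmax j hj)

lemma exists_hasLead_of_mem_span {ι A : Type*} [AddCommGroup A] [Module k A] {v : ι → A}
    (f : A →ₗ[k] TwistedAlg s ω) {d : ι → G} (hd : Function.Injective d)
    (hv : ∀ i, HasLead (f (v i)) (d i)) {y : A} (hy : y ∈ Submodule.span k (Set.range v))
    (hy0 : y ≠ 0) : ∃ i, HasLead (f y) (d i) := by
  obtain ⟨c, rfl⟩ := (Finsupp.mem_span_range_iff_exists_finsupp).1 hy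
  rw [← Finsupp.linearCombination_apply, Finsupp.apply_linearCombination]
  exact exists_hasLead_linearCombination hd hv (c := c) (by rintro rfl; simp at hy0)

variable [IsOrderedAddMonoid G]

lemma HasLead.coeff_mul {y z : TwistedAlg s ω} {g h : G} (hy : HasLead y g) (hz : HasLead z h) :
    coeff (g + h) (y * z) = (s : k) ^ ω g h * coeff g y * coeff h z :=
  coeff_mul_of_uniqueAdd fun _ _ hg' hh' ↦ (add_eq_add_iff_eq_and_eq
    (hy.2 _ (mem_support.1 hg')) (hz.2 _ (mem_support.1 hh'))).1

lemma HasLead.mul {y z : TwistedAlg s ω} {g h : G} (hy : HasLead y g) (hz : HasLead z h) :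
    HasLead (y * z) (g + h) := by
  refine ⟨?_, fun u hu ↦ ?_⟩
  · rw [hy.coeff_mul hz]
    exact mul_ne_zero (mul_ne_zero (zpow_ne_zero _ s.ne_zero) hy.1) hz.1
  · obtain ⟨g', h', rfl, hg', hh'⟩ := exists_of_coeff_mul_ne_zero hu
    exact add_le_add (hy.2 _ hg') (hz.2 _ hh')

lemma HasLead.pow {y : TwistedAlg s ω} {g : G} (hy : HasLead y g) (n : ℕ) :
    HasLead (y ^ n) (n • g) := by
  induction n with
  | zero => simpa only [pow_zero, zero_nsmul] using isMonomial_one.hasLead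
  | succ n ih => rw [pow_succ, succ_nsmul]; exact ih.mul hy

lemma HasLead.zpow_eq_of_mul_eq_smul_mul {y z : TwistedAlg s ω} {g h : G} {c : k}
    (hy : HasLead y g) (hz : HasLead z h) (hyz : y * z = c • (z * y)) :
    (s : k) ^ (ω g h - ω h g) = c := by
  have hcoeff := congrArg (coeff (g + h)) hyz
  rw [hy.coeff_mul hz, map_smul, add_comm g h, hz.coeff_mul hy, smul_eq_mul] at hcoeff
  rw [zpow_sub₀ s.ne_zero, div_eq_iff (zpow_ne_zero _ s.ne_zero)]
  apply mul_right_cancel₀ (mul_ne_zero hy.1 hz.1)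
  linear_combination hcoeff

end Order

end TwistedAlg

namespace HeisenbergDouble

/-! ### Split generators of the Heisenberg double -/

section QCommute

variable {k B : Type*} [Field k] [Ring B] [Algebra k B] {s : kˣ} {m n : ℤ} {y y' z z' : B}

/-- `y` and `z` commute up to the factor `s ^ n`. -/
def QCommute (s : kˣ) (n : ℤ) (y z : B) : Prop := y * z = (s : k) ^ n • (z * y)

lemma qCommute_zero : QCommute s 0 y z ↔ Commute y z := by
  rw [QCommute, zpow_zero, one_smul, Commute, SemiconjBy]

lemma val_zpow_of_mul_eq_one {t : kˣ} (h : s * t = 1) (n : ℤ) : (t : k) ^ n = (s : k) ^ (-n) := by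
  rw [eq_inv_of_mul_eq_one_right h, Units.val_inv_eq_inv_val, inv_zpow, zpow_neg]

lemma qCommute_iff_of_mul_eq_one {t : kˣ} (h : s * t = 1) :
    QCommute t n y z ↔ QCommute s (-n) y z := by
  rw [QCommute, QCommute, val_zpow_of_mul_eq_one h]

namespace QCommute

lemma symm (h : QCommute s n y z) : QCommute s (-n) z y := by
  rw [QCommute, h, smul_smul, ← zpow_add₀ s.ne_zero, neg_add_cancel, zpow_zero, one_smul]

lemma mul_left (h : QCommute s m y z) (h' : QCommute s n y' z) :
    QCommute s (m + n) (y * y') z := by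
  rw [QCommute, mul_assoc, h', mul_smul_comm, ← mul_assoc, h, smul_mul_assoc, smul_smul,
    mul_assoc, ← zpow_add₀ s.ne_zero, add_comm]

lemma mul_right (h : QCommute s m y z) (h' : QCommute s n y z') :
    QCommute s (m + n) y (z * z') := by
  have := (h.symm.mul_left h'.symm).symm
  rwa [neg_add, neg_neg, neg_neg] at this

lemma smul_left (h : QCommute s n y z) (r : k) : QCommute s n (r • y) z := by
  rw [QCommute, smul_mul_assoc, h, mul_smul_comm, smul_comm]

lemma smul_right (h : QCommute s n y z) (r : k) : QCommute s n y (r • z) := by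
  rw [QCommute, mul_smul_comm, h, smul_mul_assoc, smul_comm]

lemma of_smul_right {r : k} (hr : r ≠ 0) (h : QCommute s n y (r • z)) : QCommute s n y z := by
  simpa only [smul_smul, inv_mul_cancel₀ hr, one_smul] using h.smul_right r⁻¹

lemma map {B' : Type*} [Ring B'] [Algebra k B'] (f : B →ₐ[k] B') (h : QCommute s n y z) :
    QCommute s n (f y) (f z) := by
  rw [QCommute, ← map_mul, h, map_smul, map_mul]

lemma pow_right (h : QCommute s n y z) (j : ℕ) : QCommute s (n * j) y (z ^ j) := by
  induction j with
  | zero => simpa using qCommute_zero.2 (Commute.one_right y)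
  | succ j ih =>
    rw [pow_succ, Nat.cast_succ, mul_add, mul_one]
    exact ih.mul_right h

lemma units_inv_right {u : Bˣ} (h : QCommute s n y u) : QCommute s (-n) y (u⁻¹ : Bˣ) := by
  rw [QCommute, Units.mul_inv_eq_iff_eq_mul, smul_mul_assoc, mul_assoc, h, mul_smul_comm,
    Units.inv_mul_cancel_left, smul_smul, ← zpow_add₀ s.ne_zero, neg_add_cancel, zpow_zero,
    one_smul]

lemma units_zpow_right {u : Bˣ} (h : QCommute s n y u) (j : ℤ) :
    QCommute s (n * j) y (u ^ j : Bˣ) := by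
  obtain ⟨j, rfl | rfl⟩ := j.eq_nat_or_neg
  · simpa only [zpow_natCast, Units.val_pow_eq_pow_val] using h.pow_right j
  · rw [zpow_neg, zpow_natCast, mul_neg]
    refine units_inv_right ?_
    simpa only [Units.val_pow_eq_pow_val] using h.pow_right j

end QCommute

end QCommute

/-- The unit `s` is not a root of unity. -/
class Generic {k : Type*} [Field k] (s : kˣ) : Prop where
  eq_zero_of_zpow_eq_one : ∀ n : ℤ, (s : k) ^ n = 1 → n = 0

namespace Generic

variable {k : Type*} [Field k] (s : kˣ) [Generic s]

lemma zpow_injective : Function.Injective fun n : ℤ ↦ (s : k) ^ n := fun m n h ↦ by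
  have := eq_zero_of_zpow_eq_one (s := s) (m - n) (by
    rw [zpow_sub₀ s.ne_zero, div_eq_one_iff_eq (zpow_ne_zero _ s.ne_zero)]
    exact h)
  exact sub_eq_zero.1 this

lemma zpow_sub_zpow_ne_zero {m n : ℤ} (h : m ≠ n) : (s : k) ^ m - (s : k) ^ n ≠ 0 :=
  sub_ne_zero.2 ((zpow_injective s).ne h)

variable {s} in
lemma of_mul_eq_one {t : kˣ} (h : s * t = 1) : Generic t where
  eq_zero_of_zpow_eq_one n hn := neg_eq_zero.1 <| eq_zero_of_zpow_eq_one (s := s) (-n) <| by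
    rwa [← val_zpow_of_mul_eq_one h]

end Generic

/-- Elements of `B` satisfying the relations of `D_q`, `q = s²`, in generators that split off a
quantum torus: `w r t` stands for `s ^ (r t) K ^ r a ^ t`, and `b`, `f`, `c`, `e` for the
generators `b`, `F`, `c`, `E`, multiplied by elements of the torus and by scalars so as to commute
with the torus. -/
structure SplitGens {k : Type*} [Field k] (s : kˣ) (B : Type*) [Ring B] [Algebra k B] where
  w : ℤ → ℤ → B
  b : B
  f : B
  c : B
  e : B
  w_zero : w 0 0 = 1
  w_mul : ∀ r t r' t', w r t * w r' t' = (s : k) ^ (t * r' - r * t') • w (r + r') (t + t')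
  b_w : ∀ r t, Commute b (w r t)
  f_w : ∀ r t, Commute f (w r t)
  c_w : ∀ r t, Commute c (w r t)
  e_w : ∀ r t, Commute e (w r t)
  f_b : f * b = (s : k) ^ (-4 : ℤ) • (b * f) + (1 - (s : k) ^ (-4 : ℤ)) • 1
  e_c : e * c = (s : k) ^ (4 : ℤ) • (c * e) + (1 - (s : k) ^ (4 : ℤ)) • 1
  b_c : QCommute s 4 b c
  f_c : QCommute s (-4) f c
  b_e : QCommute s (-4) b e
  f_e : QCommute s 4 f e

namespace SplitGens

section Lift

variable {k : Type*} [Field k] {s : kˣ} {B : Type*} [Ring B] [Algebra k B] (d : SplitGens s B)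

/-- The scalar `κ` in `F = κ w(-1, 2) f`. -/
def scalarF (s : kˣ) : k := ((s : k) ^ (1 : ℤ) - (s : k) ^ (-3 : ℤ))⁻¹

/-- The scalar `κ` in `E = κ w(0, -2) e`. -/
def scalarE (s : kˣ) : k := ((s : k) ^ (-1 : ℤ) - (s : k) ^ (3 : ℤ))⁻¹

lemma scalarF_mul_sub (s : kˣ) [Generic s] :
    scalarF s * ((s : k) ^ (1 : ℤ) - (s : k) ^ (-3 : ℤ)) = 1 :=
  inv_mul_cancel₀ (Generic.zpow_sub_zpow_ne_zero s (by norm_num))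

lemma scalarF_ne_zero (s : kˣ) [Generic s] : scalarF s ≠ 0 :=
  left_ne_zero_of_mul_eq_one (scalarF_mul_sub s)

lemma scalarE_mul_sub (s : kˣ) [Generic s] :
    scalarE s * ((s : k) ^ (-1 : ℤ) - (s : k) ^ (3 : ℤ)) = 1 :=
  inv_mul_cancel₀ (Generic.zpow_sub_zpow_ne_zero s (by norm_num))

lemma scalarE_ne_zero (s : kˣ) [Generic s] : scalarE s ≠ 0 :=
  left_ne_zero_of_mul_eq_one (scalarE_mul_sub s)

/-- The elements of `B` in the roles of the generators of `D_q`. -/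
def genImage : Gen → B
  | .a => d.w 0 1
  | .aInv => d.w 0 (-1)
  | .b => d.w 1 (-1) * d.b
  | .c => d.w 1 1 * d.c
  | .K => d.w 1 0
  | .KInv => d.w (-1) 0
  | .E => scalarE s • (d.w 0 (-2) * d.e)
  | .F => scalarF s • (d.w (-1) 2 * d.f)

lemma w_mul_mul (r t r' t' : ℤ) (y : B) :
    d.w r t * (d.w r' t' * y) = (s : k) ^ (t * r' - r * t') • (d.w (r + r') (t + t') * y) := by
  rw [← mul_assoc, d.w_mul, smul_mul_assoc]

variable {d} in
lemma mul_mul_w_mul {y : B} (hy : ∀ r t, Commute y (d.w r t)) (r t r' t' : ℤ) (z : B) :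
    d.w r t * y * (d.w r' t' * z) =
      (s : k) ^ (t * r' - r * t') • (d.w (r + r') (t + t') * (y * z)) := by
  rw [mul_assoc, ← mul_assoc y, (hy _ _).eq, mul_assoc, w_mul_mul]

variable {d} in
lemma mul_mul_w {y : B} (hy : ∀ r t, Commute y (d.w r t)) (r t r' t' : ℤ) :
    d.w r t * y * d.w r' t' = (s : k) ^ (t * r' - r * t') • (d.w (r + r') (t + t') * y) := by
  simpa only [mul_one] using mul_mul_w_mul hy r t r' t' 1

lemma lift_genImage_eq_of_rel [Generic s] {y z : FreeAlgebra k Gen} (h : Rel k (s ^ 2) y z) :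
    FreeAlgebra.lift k d.genImage y = FreeAlgebra.lift k d.genImage z := by
  have hs := s.ne_zero
  have hF := scalarF_mul_sub s
  have hE := scalarE_mul_sub s
  have b_c : d.b * d.c = _ := d.b_c
  have f_c : d.f * d.c = _ := d.f_c
  have b_e : d.b * d.e = _ := d.b_e
  have f_e : d.f * d.e = _ := d.f_e
  norm_num at hF hE
  field_simp at hF hE
  induction h <;>
  simp only [gen, map_mul, map_smul, map_add, map_one, FreeAlgebra.lift_ι_apply, genImage,
    smul_mul_assoc, mul_smul_comm, smul_smul, mul_mul_w_mul d.b_w, mul_mul_w_mul d.c_w,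
    mul_mul_w_mul d.e_w, mul_mul_w_mul d.f_w, mul_mul_w d.b_w, mul_mul_w d.c_w, mul_mul_w d.e_w,
    mul_mul_w d.f_w, d.w_mul_mul, d.w_mul, d.f_b, d.e_c, b_c, f_c, b_e, f_e, mul_add, mul_one,
    smul_add] <;> norm_num [d.w_zero]
  case E_c =>
    match_scalars <;> field_simp
    linear_combination hE
  case F_b =>
    match_scalars <;> field_simp
    linear_combination hF
  all_goals
    congr 1
    field_simp

/-- The homomorphism from `D_q` that takes the split generators of `D_q` to those of `B`. -/
noncomputable def lift [Generic s] : D k (s ^ 2) →ₐ[k] B :=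
  RingQuot.liftAlgHom k ⟨FreeAlgebra.lift k d.genImage, fun _ _ h ↦ d.lift_genImage_eq_of_rel h⟩

lemma lift_x [Generic s] (g : Gen) : d.lift (x k (s ^ 2) g) = d.genImage g := by
  simp [lift, x, gen]

end Lift

end SplitGens

section Torus

variable {k : Type*} [Field k]

/-- The symmetrized monomial `s ^ (r t) K ^ r a ^ t`, for `q = s²`. -/
noncomputable def W (s : kˣ) (r t : ℤ) : D k (s ^ 2) := (s : k) ^ (r * t) • KA k (s ^ 2) r t

variable {s : kˣ}

local notation "𝔻" => D k (s ^ 2)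
local notation "X" => x k (s ^ 2)

lemma mkAlgHom_eq_of_rel {y z : FreeAlgebra k Gen} (h : Rel k (s ^ 2) y z) :
    RingQuot.mkAlgHom k (Rel k (s ^ 2)) y = RingQuot.mkAlgHom k (Rel k (s ^ 2)) z :=
  RingQuot.mkAlgHom_rel k h

lemma qCommute_x {g h : Gen} {r : k} {n : ℤ}
    (hrel : Rel k (s ^ 2) (gen k g * gen k h) (r • (gen k h * gen k g)))
    (hr : r = (s : k) ^ n) : QCommute s n (X g) (X h) := by
  simpa only [QCommute, x, map_mul, map_smul, hr] using mkAlgHom_eq_of_rel hrel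

lemma qCommute_x_zero {g h : Gen}
    (hrel : Rel k (s ^ 2) (gen k g * gen k h) (gen k h * gen k g)) :
    QCommute s 0 (X g) (X h) :=
  qCommute_zero.2 <| by simpa only [Commute, SemiconjBy, x, map_mul] using mkAlgHom_eq_of_rel hrel

lemma x_E_mul_x_c : X .E * X .c = X .c * X .E + X .aInv * X .K := by
  simpa only [x, map_mul, map_add] using mkAlgHom_eq_of_rel (Rel.E_c (k := k) (q := s ^ 2))

lemma x_F_mul_x_b : X .F * X .b = (s : k) ^ (-2 : ℤ) • (X .b * X .F) + X .a := by
  simpa only [x, map_mul, map_add, map_smul, Units.val_pow_eq_pow_val, zpow_neg, zpow_ofNat] using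
    mkAlgHom_eq_of_rel (Rel.F_b (k := k) (q := s ^ 2))

lemma qCommute_a_K : QCommute s 2 (X .a) (X .K) := by
  have K_a : QCommute s (-2) (X .K) (X .a) := qCommute_x Rel.K_a (by simp)
  exact K_a.symm

lemma W_zero : W s 0 0 = 1 := by simp [W, KA]
lemma x_a : X .a = W s 0 1 := by simp [W, KA, aUnit]
lemma x_aInv : X .aInv = W s 0 (-1) := by simp [W, KA, aUnit]
lemma x_K : X .K = W s 1 0 := by simp [W, KA, KUnit]
lemma x_KInv : X .KInv = W s (-1) 0 := by simp [W, KA, KUnit]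

lemma QCommute.W_right {y : 𝔻} {m n : ℤ} (hK : QCommute s m y (X .K))
    (ha : QCommute s n y (X .a)) (r t : ℤ) : QCommute s (m * r + n * t) y (W s r t) :=
  ((hK.units_zpow_right (u := KUnit k (s ^ 2)) r).mul_right
    (ha.units_zpow_right (u := aUnit k (s ^ 2)) t)).smul_right _

lemma qCommute_aUnit_zpow_KUnit_zpow (t r : ℤ) : QCommute s (2 * t * r)
    ((aUnit k (s ^ 2) ^ t : (𝔻)ˣ) : 𝔻) ((KUnit k (s ^ 2) ^ r : (𝔻)ˣ) : 𝔻) := by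
  have a_K : QCommute s 2 (aUnit k (s ^ 2) : 𝔻) (KUnit k (s ^ 2)) := qCommute_a_K
  have a_K_zpow := a_K.units_zpow_right r
  have h := (a_K_zpow.symm.units_zpow_right t).symm
  rwa [neg_mul, neg_neg, mul_right_comm] at h

lemma KA_mul (r t r' t' : ℤ) : KA k (s ^ 2) r t * KA k (s ^ 2) r' t' =
    (s : k) ^ (2 * t * r') • KA k (s ^ 2) (r + r') (t + t') := by
  have h : _ * _ = _ := qCommute_aUnit_zpow_KUnit_zpow (s := s) t r'
  simp only [KA, Units.val_mul, zpow_add]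
  rw [mul_assoc, ← mul_assoc _ _ ((aUnit k (s ^ 2) ^ t' : (𝔻)ˣ) : 𝔻), h]
  simp only [smul_mul_assoc, mul_smul_comm, mul_assoc]

lemma W_mul (r t r' t' : ℤ) : W s r t * W s r' t' =
    (s : k) ^ (t * r' - r * t') • W s (r + r') (t + t') := by
  simp only [W, smul_mul_assoc, mul_smul_comm, KA_mul, smul_smul, ← zpow_add₀ s.ne_zero]
  congr 2
  ring

lemma qCommute_W (r t r' t' : ℤ) :
    QCommute s (2 * (t * r' - r * t')) (W s r t) (W s r' t') := by
  rw [QCommute, W_mul, W_mul, smul_smul, ← zpow_add₀ s.ne_zero, add_comm r, add_comm t]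
  congr 2
  ring

lemma qCommute_b_W : ∀ r t, QCommute s (-2 * r + -2 * t) (X .b) (W s r t) :=
  QCommute.W_right (qCommute_x Rel.K_b (by simp)).symm (qCommute_x Rel.a_b (by simp)).symm

lemma qCommute_c_W : ∀ r t, QCommute s (2 * r + -2 * t) (X .c) (W s r t) :=
  QCommute.W_right (qCommute_x (n := -2) Rel.K_c (by simp)).symm
    (qCommute_x Rel.a_c (by simp)).symm

lemma qCommute_F_W : ∀ r t, QCommute s (4 * r + 2 * t) (X .F) (W s r t) :=
  QCommute.W_right (qCommute_x (n := -4) Rel.K_F (by simp [← pow_mul])).symm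
    (qCommute_x Rel.F_a (by simp))

lemma qCommute_E_W : ∀ r t, QCommute s (-4 * r + 0 * t) (X .E) (W s r t) :=
  QCommute.W_right (qCommute_x Rel.K_E (by simp [← pow_mul])).symm (qCommute_x_zero Rel.E_a)

variable {m n m' n' : ℤ} {y z : D k (s ^ 2)}

lemma commute_W_mul_W (hy : ∀ i j, QCommute s (m * i + n * j) y (W s i j)) (p r : ℤ)
    (hm : m = -2 * r) (hn : n = 2 * p) (i j : ℤ) : Commute (W s p r * y) (W s i j) := by
  have h := (qCommute_W p r i j).mul_left (hy i j)
  rw [hm, hn] at h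
  ring_nf at h
  exact qCommute_zero.1 h

lemma qCommute_W_mul_W_mul (hy : ∀ i j, QCommute s (m * i + n * j) y (W s i j))
    (hz : ∀ i j, QCommute s (m' * i + n' * j) z (W s i j)) {l : ℤ} (hyz : QCommute s l y z)
    (p r p' r' : ℤ) :
    QCommute s (2 * (r * p' - p * r') - (m' * p + n' * r) + (m * p' + n * r') + l)
      (W s p r * y) (W s p' r' * z) := by
  convert ((qCommute_W p r p' r').mul_right (hz p r).symm).mul_left
    ((hy p' r').mul_right hyz) using 1
  ring

lemma W_mul_mul_W_mul (hy : ∀ i j, QCommute s (m * i + n * j) y (W s i j)) (p r i j : ℤ)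
    (z : 𝔻) : W s p r * y * (W s i j * z) =
      (s : k) ^ (m * i + n * j + (r * i - p * j)) • (W s (p + i) (r + j) * (y * z)) := by
  rw [mul_assoc, ← mul_assoc y, hy, smul_mul_assoc, mul_smul_comm, ← mul_assoc, ← mul_assoc, W_mul,
    smul_mul_assoc, smul_mul_assoc, smul_smul, ← zpow_add₀ s.ne_zero, mul_assoc]

variable (s) in
/-- The split generators of `D_q` itself. -/
noncomputable def canonical [Generic s] : SplitGens s (D k (s ^ 2)) where
  w := W s
  b := W s (-1) 1 * x k (s ^ 2) .b
  f := (SplitGens.scalarF s)⁻¹ • (W s 1 (-2) * x k (s ^ 2) .F)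
  c := W s (-1) (-1) * x k (s ^ 2) .c
  e := (SplitGens.scalarE s)⁻¹ • (W s 0 2 * x k (s ^ 2) .E)
  w_zero := W_zero
  w_mul := W_mul
  b_w := commute_W_mul_W qCommute_b_W _ _ (by norm_num) (by norm_num)
  c_w := commute_W_mul_W qCommute_c_W _ _ (by norm_num) (by norm_num)
  f_w i j := .smul_left (commute_W_mul_W qCommute_F_W _ _ (by norm_num) (by norm_num) i j) _
  e_w i j := .smul_left (commute_W_mul_W qCommute_E_W _ _ (by norm_num) (by norm_num) i j) _
  f_b := by
    simp only [smul_mul_assoc, mul_smul_comm, W_mul_mul_W_mul qCommute_F_W,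
      W_mul_mul_W_mul qCommute_b_W, x_F_mul_x_b, mul_add, x_a, W_mul]
    norm_num [W_zero, SplitGens.scalarF]
    match_scalars <;> field_simp
  e_c := by
    simp only [smul_mul_assoc, mul_smul_comm, W_mul_mul_W_mul qCommute_E_W,
      W_mul_mul_W_mul qCommute_c_W, x_E_mul_x_c, mul_add, x_aInv, x_K, W_mul]
    norm_num [W_zero, SplitGens.scalarE]
    match_scalars <;> field_simp
  b_c := qCommute_W_mul_W_mul qCommute_b_W qCommute_c_W (qCommute_x_zero Rel.b_c) _ _ _ _
  f_c := (qCommute_W_mul_W_mul qCommute_F_W qCommute_c_W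
    (qCommute_x (s := s) (n := 2) Rel.F_c (by simp)) _ _ _ _).smul_left _
  b_e := (qCommute_W_mul_W_mul qCommute_b_W qCommute_E_W (qCommute_x_zero Rel.E_b).symm _ _ _ _
    ).smul_right _
  f_e := ((qCommute_W_mul_W_mul qCommute_F_W qCommute_E_W (qCommute_x_zero Rel.E_F).symm _ _ _ _
    ).smul_left _).smul_right _

end Torus

namespace SplitGens

variable {k : Type*} [Field k] {s : kˣ} {B : Type*} [Ring B] [Algebra k B] (d : SplitGens s B)

lemma w_mul_w_neg (r t : ℤ) : d.w r t * d.w (-r) (-t) = 1 := by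
  rw [d.w_mul]
  simp [d.w_zero, mul_comm]

/-- The torus elements as units. -/
def wUnit (r t : ℤ) : Bˣ where
  val := d.w r t
  inv := d.w (-r) (-t)
  val_inv := d.w_mul_w_neg r t
  inv_val := by simpa using d.w_mul_w_neg (-r) (-t)

lemma coe_wUnit (r t : ℤ) : (d.wUnit r t : B) = d.w r t := rfl

lemma coe_wUnit_zpow (r t n : ℤ) : ((d.wUnit r t ^ n : Bˣ) : B) = d.w (n * r) (n * t) := by
  have h : ∀ m : ℕ, ((d.wUnit r t ^ m : Bˣ) : B) = d.w (m * r) (m * t) := fun m ↦ by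
    induction m with
    | zero => simp [d.w_zero]
    | succ m ih =>
      rw [pow_succ, Units.val_mul, ih, coe_wUnit, d.w_mul, mul_right_comm,
        sub_self, zpow_zero, one_smul]
      push_cast
      rw [add_mul, add_mul, one_mul, one_mul]
  obtain ⟨m, rfl | rfl⟩ := n.eq_nat_or_neg
  · simpa using h m
  · rw [zpow_neg, zpow_natCast, Units.inv_eq_of_mul_eq_one_right (a := d.w (-m * r) (-m * t))]
    rw [h, neg_mul, neg_mul, w_mul_w_neg]

/-- The symmetry of the relations that exchanges `K` with `a`, `b` with `c`, `F` with `E` and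
inverts `s`. -/
def swap {t : kˣ} (h : s * t = 1) : SplitGens t B where
  w i j := d.w j i
  b := d.c
  f := d.e
  c := d.b
  e := d.f
  w_zero := d.w_zero
  w_mul i j i' j' := by
    rw [d.w_mul, val_zpow_of_mul_eq_one h]
    congr 2
    ring
  b_w _ _ := d.c_w _ _
  f_w _ _ := d.e_w _ _
  c_w _ _ := d.b_w _ _
  e_w _ _ := d.f_w _ _
  f_b := by simpa only [val_zpow_of_mul_eq_one h, neg_neg] using d.e_c
  e_c := by simpa only [val_zpow_of_mul_eq_one h] using d.f_b
  b_c := (qCommute_iff_of_mul_eq_one h).2 d.b_c.symm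
  f_c := (qCommute_iff_of_mul_eq_one h).2 d.b_e.symm
  b_e := (qCommute_iff_of_mul_eq_one h).2 d.f_c.symm
  f_e := (qCommute_iff_of_mul_eq_one h).2 d.f_e.symm

/-- The normal element `1 - b f`, the counterpart of `φ`. -/
def phi : B := 1 - d.b * d.f

/-- The normal element `1 - c e`, the counterpart of `ψ`. -/
def psi : B := 1 - d.c * d.e

lemma b_mul_f : d.b * d.f = 1 - d.phi := by rw [phi, sub_sub_cancel]

lemma c_mul_e : d.c * d.e = 1 - d.psi := by rw [psi, sub_sub_cancel]

lemma f_mul_b : d.f * d.b = 1 - (s : k) ^ (-4 : ℤ) • d.phi := by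
  rw [d.f_b, b_mul_f]
  module

lemma e_mul_c : d.e * d.c = 1 - (s : k) ^ (4 : ℤ) • d.psi := by
  rw [d.e_c, c_mul_e]
  module

lemma qCommute_b_phi : QCommute s 4 d.b d.phi := by
  have phi_mul_b : d.phi * d.b = (s : k) ^ (-4 : ℤ) • (d.b * d.phi) := by
    rw [phi, sub_mul, mul_assoc, f_mul_b, mul_sub, mul_smul_comm, one_mul, mul_one, sub_sub_cancel,
      phi]
  exact QCommute.symm phi_mul_b

lemma qCommute_f_phi : QCommute s (-4) d.f d.phi := by
  rw [QCommute, phi, mul_sub, ← mul_assoc, f_mul_b, sub_mul, smul_mul_assoc, one_mul, mul_one,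
    sub_sub_cancel, phi]

lemma qCommute_c_psi : QCommute s (-4) d.c d.psi :=
  (qCommute_iff_of_mul_eq_one (mul_inv_cancel s)).1 (d.swap (mul_inv_cancel s)).qCommute_b_phi

lemma qCommute_e_psi : QCommute s 4 d.e d.psi :=
  (qCommute_iff_of_mul_eq_one (mul_inv_cancel s)).1 (d.swap (mul_inv_cancel s)).qCommute_f_phi

variable {d} in
lemma commute_phi_of_qCommute {n : ℤ} {y : B} (hb : QCommute s n d.b y)
    (hf : QCommute s (-n) d.f y) : Commute d.phi y := by
  have h := hb.mul_left hf
  rw [add_neg_cancel, qCommute_zero] at h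
  exact (Commute.one_left y).sub_left h

lemma commute_phi_w (r t : ℤ) : Commute d.phi (d.w r t) :=
  (Commute.one_left _).sub_left ((d.b_w r t).mul_left (d.f_w r t))

lemma commute_phi_c : Commute d.phi d.c := commute_phi_of_qCommute d.b_c d.f_c

lemma commute_phi_e : Commute d.phi d.e := commute_phi_of_qCommute d.b_e d.f_e

lemma commute_phi_psi : Commute d.phi d.psi :=
  (Commute.one_right _).sub_right (d.commute_phi_c.mul_right d.commute_phi_e)

lemma commute_psi_w (r t : ℤ) : Commute d.psi (d.w r t) :=
  (d.swap (mul_inv_cancel s)).commute_phi_w t r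

lemma commute_psi_b : Commute d.psi d.b := (d.swap (mul_inv_cancel s)).commute_phi_c

lemma commute_psi_f : Commute d.psi d.f := (d.swap (mul_inv_cancel s)).commute_phi_e

end SplitGens

section Generators

variable {k : Type*} [Field k] {s : kˣ} [Generic s]

local notation "𝔻" => D k (s ^ 2)
local notation "X" => x k (s ^ 2)

lemma x_b : X .b = W s 1 (-1) * (canonical s).b := by
  simp [canonical, ← mul_assoc, W_mul, W_zero]

lemma x_c : X .c = W s 1 1 * (canonical s).c := by
  simp [canonical, ← mul_assoc, W_mul, W_zero]

lemma x_F : X .F = SplitGens.scalarF s • (W s (-1) 2 * (canonical s).f) := by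
  simp [canonical, ← mul_assoc, W_mul, W_zero, smul_smul, SplitGens.scalarF_ne_zero, mul_comm]

lemma x_E : X .E = SplitGens.scalarE s • (W s 0 (-2) * (canonical s).e) := by
  simp [canonical, ← mul_assoc, W_mul, W_zero, smul_smul, SplitGens.scalarE_ne_zero]

lemma genImage_canonical : (canonical s).genImage = X := by
  funext g
  cases g
  exacts [x_a.symm, x_aInv.symm, x_b.symm, x_c.symm, x_K.symm, x_KInv.symm, x_E.symm, x_F.symm]

omit [Generic s] in
lemma adjoin_range_x : Algebra.adjoin k (Set.range (X)) = ⊤ := by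
  have h := congrArg (Subalgebra.map (RingQuot.mkAlgHom k (Rel k (s ^ 2))))
    (FreeAlgebra.adjoin_range_ι k Gen)
  rw [AlgHom.map_adjoin, Algebra.map_top, ← Set.range_comp,
    (AlgHom.range_eq_top _).2 (RingQuot.mkAlgHom_surjective k (Rel k (s ^ 2)))] at h
  exact h

lemma eq_top_of_canonical_mem (A : Subalgebra k 𝔻) (w_mem : ∀ r t, W s r t ∈ A)
    (b_mem : (canonical s).b ∈ A) (f_mem : (canonical s).f ∈ A) (c_mem : (canonical s).c ∈ A)
    (e_mem : (canonical s).e ∈ A) : A = ⊤ := by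
  rw [eq_top_iff, ← adjoin_range_x, Algebra.adjoin_le_iff, ← genImage_canonical]
  rintro _ ⟨g, rfl⟩
  cases g
  exacts [w_mem _ _, w_mem _ _, A.mul_mem (w_mem _ _) b_mem, A.mul_mem (w_mem _ _) c_mem,
    w_mem _ _, w_mem _ _, A.smul_mem (A.mul_mem (w_mem _ _) e_mem) _,
    A.smul_mem (A.mul_mem (w_mem _ _) f_mem) _]

/-- The elements that map a subspace of an algebra into itself by left multiplication. -/
def leftStabilizer {A : Type*} [Ring A] [Algebra k A] (S : Submodule k A) : Subalgebra k A where
  carrier := {y | ∀ z ∈ S, y * z ∈ S}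
  mul_mem' := fun {y y'} hy hy' z hz ↦ by rw [mul_assoc]; exact hy _ (hy' _ hz)
  add_mem' := fun {y y'} hy hy' z hz ↦ by rw [add_mul]; exact S.add_mem (hy _ hz) (hy' _ hz)
  algebraMap_mem' := fun r z hz ↦ by rw [← Algebra.smul_def]; exact S.smul_mem r hz

lemma algHom_ext_canonical {B : Type*} [Ring B] [Algebra k B] {f g : 𝔻 →ₐ[k] B}
    (hw : ∀ r t, f (W s r t) = g (W s r t)) (hb : f (canonical s).b = g (canonical s).b)
    (hf : f (canonical s).f = g (canonical s).f) (hc : f (canonical s).c = g (canonical s).c)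
    (he : f (canonical s).e = g (canonical s).e) : f = g :=
  AlgHom.ext fun z ↦
    (eq_top_of_canonical_mem (AlgHom.equalizer f g) hw hb hf hc he ▸ Algebra.mem_top :
      z ∈ AlgHom.equalizer f g)

namespace SplitGens

variable {B : Type*} [Ring B] [Algebra k B] (d : SplitGens s B)

omit [Generic s] in
lemma map_W_of {f : 𝔻 →ₐ[k] B} (hK : f (X .K) = d.w 1 0) (ha : f (X .a) = d.w 0 1) (r t : ℤ) :
    f (W s r t) = d.w r t := by
  have map_KUnit : Units.map (f : 𝔻 →* B) (KUnit k (s ^ 2)) = d.wUnit 1 0 := Units.ext hK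
  have map_aUnit : Units.map (f : 𝔻 →* B) (aUnit k (s ^ 2)) = d.wUnit 0 1 := Units.ext ha
  have map_KA : f (KA k (s ^ 2) r t) = d.w r 0 * d.w 0 t := by
    change ((Units.map (f : 𝔻 →* B) (KUnit k (s ^ 2) ^ r * aUnit k (s ^ 2) ^ t) : Bˣ) : B) = _
    rw [map_mul, map_zpow, map_zpow, map_KUnit, map_aUnit, Units.val_mul, d.coe_wUnit_zpow,
      d.coe_wUnit_zpow]
    simp
  rw [W, map_smul, map_KA, d.w_mul, smul_smul, ← zpow_add₀ s.ne_zero]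
  simp

@[simp]
lemma lift_W (r t : ℤ) : d.lift (W s r t) = d.w r t :=
  d.map_W_of (d.lift_x .K) (d.lift_x .a) r t

@[simp]
lemma lift_b : d.lift (canonical s).b = d.b := by
  simp [canonical, lift_x, genImage, ← mul_assoc, d.w_mul, d.w_zero]

@[simp]
lemma lift_c : d.lift (canonical s).c = d.c := by
  simp [canonical, lift_x, genImage, ← mul_assoc, d.w_mul, d.w_zero]

@[simp]
lemma lift_f : d.lift (canonical s).f = d.f := by
  simp [canonical, lift_x, genImage, ← mul_assoc, d.w_mul, d.w_zero, smul_smul, mul_comm,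
    scalarF_ne_zero]

@[simp]
lemma lift_e : d.lift (canonical s).e = d.e := by
  simp [canonical, lift_x, genImage, ← mul_assoc, d.w_mul, d.w_zero, smul_smul,
    scalarE_ne_zero]

@[simp]
lemma lift_phi : d.lift (canonical s).phi = d.phi := by simp [phi]

@[simp]
lemma lift_psi : d.lift (canonical s).psi = d.psi := by simp [psi]

end SplitGens

lemma phi_eq : HeisenbergDouble.phi k (s ^ 2) = W s 0 1 * (canonical s).phi := by
  have hs := s.ne_zero
  have hF := SplitGens.scalarF_mul_sub s
  norm_num at hF
  field_simp at hF
  rw [HeisenbergDouble.phi, x_F, x_b, x_a, smul_mul_assoc]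
  have w_f_w_b := SplitGens.mul_mul_w_mul (canonical s).f_w (-1) 2 1 (-1) (canonical s).b
  rw [SplitGens.f_mul_b] at w_f_w_b
  change W s (-1) 2 * _ * (W s 1 (-1) * _) = _ • (W s _ _ * _) at w_f_w_b
  rw [w_f_w_b]
  norm_num [mul_sub]
  match_scalars <;> field_simp
  · linear_combination (-(s : k)) * hF
  · linear_combination hF

lemma psi_eq : HeisenbergDouble.psi k (s ^ 2) =
    (s : k) ^ (-1 : ℤ) • (W s 1 (-1) * (canonical s).psi) := by
  have hs := s.ne_zero
  have hE := SplitGens.scalarE_mul_sub s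
  norm_num at hE
  field_simp at hE
  rw [HeisenbergDouble.psi, x_E, x_c, x_aInv, x_K, smul_mul_assoc]
  have w_e_w_c := SplitGens.mul_mul_w_mul (canonical s).e_w 0 (-2) 1 1 (canonical s).c
  rw [SplitGens.e_mul_c] at w_e_w_c
  change W s 0 (-2) * _ * (W s 1 1 * _) = _ • (W s _ _ * _) at w_e_w_c
  rw [w_e_w_c, W_mul]
  norm_num [mul_sub]
  match_scalars <;> field_simp
  · linear_combination -hE
  · linear_combination hE

end Generators

/-! ### Standard monomials -/

section BiPow

variable {M : Type*} [Monoid M] (y z : M)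

/-- The `i`-th power of `y` for `i ≥ 0` and the `(-i)`-th power of `z` for `i ≤ 0`. -/
def biPow (i : ℤ) : M := y ^ i.toNat * z ^ (-i).toNat

lemma biPow_natCast (n : ℕ) : biPow y z n = y ^ n := by simp [biPow]

lemma biPow_neg_natCast (n : ℕ) : biPow y z (-n) = z ^ n := by simp [biPow]

lemma biPow_neg (i : ℤ) : biPow y z (-i) = biPow z y i := by
  obtain ⟨n, rfl | rfl⟩ := i.eq_nat_or_neg
  · rw [biPow_neg_natCast, biPow_natCast]
  · rw [neg_neg, biPow_neg_natCast, biPow_natCast]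

lemma exists_mul_biPow_eq (i : ℤ) :
    ∃ u, (u = 1 ∨ u = y * z) ∧ y * biPow y z i = u * biPow y z (i + 1) := by
  obtain hi | hi := le_or_gt 0 i
  · lift i to ℕ using hi
    refine ⟨1, .inl rfl, ?_⟩
    rw [← Nat.cast_succ, biPow_natCast, biPow_natCast, one_mul, pow_succ']
  · obtain ⟨n, rfl⟩ := Int.eq_negSucc_of_lt_zero hi
    refine ⟨y * z, .inr rfl, ?_⟩
    rw [Int.negSucc_eq, ← Nat.cast_succ, biPow_neg_natCast, Nat.cast_succ, neg_add_rev,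
      neg_add_cancel_comm, biPow_neg_natCast, pow_succ', mul_assoc]

lemma exists_mul_biPow_eq' (i : ℤ) :
    ∃ u, (u = 1 ∨ u = z * y) ∧ z * biPow y z i = u * biPow y z (i - 1) := by
  obtain ⟨u, hu, h⟩ := exists_mul_biPow_eq z y (-i)
  refine ⟨u, hu, ?_⟩
  rwa [biPow_neg, neg_add_eq_sub, ← neg_sub, biPow_neg] at h

lemma map_biPow {N F : Type*} [Monoid N] [FunLike F M N] [MonoidHomClass F M N] (f : F) (i : ℤ) :
    f (biPow y z i) = biPow (f y) (f z) i := by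
  rw [biPow, map_mul, map_pow, map_pow, biPow]

lemma QCommute.biPow_right {k B : Type*} [Field k] [Ring B] [Algebra k B] {s : kˣ} {n : ℤ}
    {g y z : B} (hy : QCommute s n g y) (hz : QCommute s (-n) g z) (i : ℤ) :
    QCommute s (n * i) g (biPow y z i) := by
  obtain ⟨j, rfl | rfl⟩ := i.eq_nat_or_neg
  · simpa only [biPow_natCast] using hy.pow_right j
  · simpa only [biPow_neg_natCast, neg_mul, mul_neg] using hz.pow_right j

end BiPow

section Std

variable {k : Type*} [Field k] {s : kˣ} {B : Type*} [Ring B] [Algebra k B]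

lemma mul_mul_eq_of_qCommute {N : ℤ} {g u y z z' : B} (hgy : QCommute s N g y)
    (hz : g * z = u * z') (huy : Commute u y) :
    g * (y * z) = (s : k) ^ N • (u * (y * z')) := by
  rw [← mul_assoc, hgy, smul_mul_assoc, mul_assoc, hz, ← mul_assoc, ← huy.eq, mul_assoc]

namespace SplitGens

variable (d : SplitGens s B)

/-- The products `w(r, t) φ ^ n ψ ^ m b ^ i c ^ l`, where `f` and `e` stand for the inverses of
`b` and `c`; they form a basis of `D_q`. -/
def std : ℕ × ℕ × ℤ × ℤ × ℤ × ℤ → B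
  | (n, m, i, l, r, t) =>
    d.w r t * (d.phi ^ n * d.psi ^ m) * (biPow d.b d.f i * biPow d.c d.e l)

lemma commute_phi_w_mul (n m : ℕ) (r t : ℤ) :
    Commute d.phi (d.w r t * (d.phi ^ n * d.psi ^ m)) :=
  (d.commute_phi_w r t).mul_right
    (((Commute.refl _).pow_right n).mul_right (d.commute_phi_psi.pow_right m))

lemma commute_psi_w_mul (n m : ℕ) (r t : ℤ) :
    Commute d.psi (d.w r t * (d.phi ^ n * d.psi ^ m)) :=
  (d.commute_psi_w r t).mul_right
    ((d.commute_phi_psi.symm.pow_right n).mul_right ((Commute.refl _).pow_right m))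

variable {d} in
lemma qCommute_w_mul {g : B} {N M : ℤ} (hw : ∀ r t, Commute g (d.w r t))
    (hphi : QCommute s N g d.phi) (hpsi : QCommute s M g d.psi) (n m : ℕ) (r t : ℤ) :
    QCommute s (N * n + M * m) g (d.w r t * (d.phi ^ n * d.psi ^ m)) := by
  have h := (qCommute_zero (s := s).2 (hw r t)).mul_right
    ((hphi.pow_right n).mul_right (hpsi.pow_right m))
  rwa [zero_add] at h

lemma commute_psi_biPow (i : ℤ) : Commute d.psi (biPow d.b d.f i) :=
  (d.commute_psi_b.pow_right _).mul_right (d.commute_psi_f.pow_right _)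

lemma phi_mul_std (n m : ℕ) (i l r t : ℤ) :
    d.phi * d.std (n, m, i, l, r, t) = d.std (n + 1, m, i, l, r, t) := by
  rw [std, std, ← mul_assoc, ← mul_assoc d.phi, (d.commute_phi_w r t).eq, pow_succ']
  simp only [mul_assoc]

lemma psi_mul_std (n m : ℕ) (i l r t : ℤ) :
    d.psi * d.std (n, m, i, l, r, t) = d.std (n, m + 1, i, l, r, t) := by
  rw [std, std, ← mul_assoc, (d.commute_psi_w_mul n m r t).eq, pow_succ]
  simp only [mul_assoc]

lemma w_mul_std (n m : ℕ) (i l r t r' t' : ℤ) : d.w r' t' * d.std (n, m, i, l, r, t) =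
    (s : k) ^ (t' * r - r' * t) • d.std (n, m, i, l, r' + r, t' + t) := by
  rw [std, std]
  simp only [mul_assoc, w_mul_mul]

lemma exists_b_mul_std (n m : ℕ) (i l r t : ℤ) : ∃ (u : B) (N : ℤ), (u = 1 ∨ u = d.b * d.f) ∧
    d.b * d.std (n, m, i, l, r, t) = (s : k) ^ N • (u * d.std (n, m, i + 1, l, r, t)) := by
  obtain ⟨u, hu, h⟩ := exists_mul_biPow_eq d.b d.f i
  refine ⟨u, _, hu, mul_mul_eq_of_qCommute (qCommute_w_mul d.b_w d.qCommute_b_phi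
    (qCommute_zero.2 d.commute_psi_b.symm) n m r t) ?_ ?_⟩
  · rw [← mul_assoc, h, mul_assoc]
  · obtain rfl | rfl := hu
    · exact Commute.one_left _
    · rw [b_mul_f]
      exact (Commute.one_left _).sub_left (d.commute_phi_w_mul n m r t)

lemma exists_f_mul_std (n m : ℕ) (i l r t : ℤ) : ∃ (u : B) (N : ℤ), (u = 1 ∨ u = d.f * d.b) ∧
    d.f * d.std (n, m, i, l, r, t) = (s : k) ^ N • (u * d.std (n, m, i - 1, l, r, t)) := by
  obtain ⟨u, hu, h⟩ := exists_mul_biPow_eq' d.b d.f i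
  refine ⟨u, _, hu, mul_mul_eq_of_qCommute (qCommute_w_mul d.f_w d.qCommute_f_phi
    (qCommute_zero.2 d.commute_psi_f.symm) n m r t) ?_ ?_⟩
  · rw [← mul_assoc, h, mul_assoc]
  · obtain rfl | rfl := hu
    · exact Commute.one_left _
    · rw [f_mul_b]
      exact (Commute.one_left _).sub_left ((d.commute_phi_w_mul n m r t).smul_left _)

lemma exists_c_mul_std (n m : ℕ) (i l r t : ℤ) : ∃ (u : B) (N : ℤ), (u = 1 ∨ u = d.c * d.e) ∧
    d.c * d.std (n, m, i, l, r, t) = (s : k) ^ N • (u * d.std (n, m, i, l + 1, r, t)) := by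
  obtain ⟨u, hu, h⟩ := exists_mul_biPow_eq d.c d.e l
  have c_f : QCommute s (-(-4)) d.c d.f := d.f_c.symm
  rw [std, std, ← mul_assoc (d.w r t * _), ← mul_assoc (d.w r t * _)]
  refine ⟨u, _, hu, mul_mul_eq_of_qCommute ((qCommute_w_mul d.c_w
    (qCommute_zero.2 d.commute_phi_c.symm) d.qCommute_c_psi n m r t).mul_right
    (d.b_c.symm.biPow_right c_f i)) h ?_⟩
  obtain rfl | rfl := hu
  · exact Commute.one_left _
  · rw [c_mul_e]
    exact (Commute.one_left _).sub_left
      ((d.commute_psi_w_mul n m r t).mul_right (d.commute_psi_biPow i))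

lemma exists_e_mul_std (n m : ℕ) (i l r t : ℤ) : ∃ (u : B) (N : ℤ), (u = 1 ∨ u = d.e * d.c) ∧
    d.e * d.std (n, m, i, l, r, t) = (s : k) ^ N • (u * d.std (n, m, i, l - 1, r, t)) := by
  obtain ⟨u, hu, h⟩ := exists_mul_biPow_eq' d.c d.e l
  have e_b : QCommute s 4 d.e d.b := d.b_e.symm
  rw [std, std, ← mul_assoc (d.w r t * _), ← mul_assoc (d.w r t * _)]
  refine ⟨u, _, hu, mul_mul_eq_of_qCommute ((qCommute_w_mul d.e_w
    (qCommute_zero.2 d.commute_phi_e.symm) d.qCommute_e_psi n m r t).mul_right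
    (e_b.biPow_right d.f_e.symm i)) h ?_⟩
  obtain rfl | rfl := hu
  · exact Commute.one_left _
  · rw [e_mul_c]
    exact (Commute.one_left _).sub_left
      (((d.commute_psi_w_mul n m r t).mul_right (d.commute_psi_biPow i)).smul_left _)

lemma lift_std [Generic s] (v : ℕ × ℕ × ℤ × ℤ × ℤ × ℤ) :
    d.lift ((canonical s).std v) = d.std v := by
  simp only [std, map_mul, map_pow, map_biPow, lift_phi, lift_psi, lift_b, lift_c, lift_e, lift_f]
  exact congrArg (· * _ * _) (d.lift_W _ _)

end SplitGens

lemma mem_leftStabilizer_span {ι : Type*} {v : ι → B} {g : B}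
    (h : ∀ i, g * v i ∈ Submodule.span k (Set.range v)) :
    g ∈ leftStabilizer (Submodule.span k (Set.range v)) := fun z hz ↦ by
  induction hz using Submodule.span_induction with
  | mem _ hz => obtain ⟨i, rfl⟩ := hz; exact h i
  | zero => rw [mul_zero]; exact zero_mem _
  | add _ _ _ _ hy hz => rw [mul_add]; exact add_mem hy hz
  | smul r _ _ hz => rw [mul_smul_comm]; exact Submodule.smul_mem _ r hz

variable (s) in
lemma leftStabilizer_span_range_std [Generic s] :
    leftStabilizer (Submodule.span k (Set.range (canonical s).std)) = ⊤ := by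
  set S := Submodule.span k (Set.range (canonical s).std)
  have std_mem (v) : (canonical s).std v ∈ S := Submodule.subset_span ⟨v, rfl⟩
  have phi_mem : (canonical s).phi ∈ leftStabilizer S := mem_leftStabilizer_span
    fun (n, m, i, l, r, t) ↦ (canonical s).phi_mul_std n m i l r t ▸ std_mem _
  have psi_mem : (canonical s).psi ∈ leftStabilizer S := mem_leftStabilizer_span
    fun (n, m, i, l, r, t) ↦ (canonical s).psi_mul_std n m i l r t ▸ std_mem _
  have mem_of_exists {g z p : D k (s ^ 2)} {v} (hp : p ∈ leftStabilizer S) (h : ∃ u, ∃ N : ℤ,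
      (u = 1 ∨ u = p) ∧ g * z = (s : k) ^ N • (u * (canonical s).std v)) : g * z ∈ S := by
    obtain ⟨u, N, rfl | rfl, h⟩ := h
    · rw [h, one_mul]
      exact S.smul_mem _ (std_mem v)
    · rw [h]
      exact S.smul_mem _ (hp _ (std_mem v))
  apply eq_top_of_canonical_mem
  · exact fun r' t' ↦ mem_leftStabilizer_span fun (n, m, i, l, r, t) ↦
      (canonical s).w_mul_std n m i l r t r' t' ▸ S.smul_mem _ (std_mem _)
  · refine mem_leftStabilizer_span fun (n, m, i, l, r, t) ↦
      mem_of_exists ?_ ((canonical s).exists_b_mul_std n m i l r t)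
    rw [SplitGens.b_mul_f]
    exact sub_mem (one_mem _) phi_mem
  · refine mem_leftStabilizer_span fun (n, m, i, l, r, t) ↦
      mem_of_exists ?_ ((canonical s).exists_f_mul_std n m i l r t)
    rw [SplitGens.f_mul_b]
    exact sub_mem (one_mem _) (Subalgebra.smul_mem _ phi_mem _)
  · refine mem_leftStabilizer_span fun (n, m, i, l, r, t) ↦
      mem_of_exists ?_ ((canonical s).exists_c_mul_std n m i l r t)
    rw [SplitGens.c_mul_e]
    exact sub_mem (one_mem _) psi_mem
  · refine mem_leftStabilizer_span fun (n, m, i, l, r, t) ↦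
      mem_of_exists ?_ ((canonical s).exists_e_mul_std n m i l r t)
    rw [SplitGens.e_mul_c]
    exact sub_mem (one_mem _) (Subalgebra.smul_mem _ psi_mem _)

variable (s) in
lemma span_range_std [Generic s] : Submodule.span k (Set.range (canonical s).std) = ⊤ := by
  have one_mem : 1 ∈ Submodule.span k (Set.range (canonical s).std) :=
    Submodule.subset_span ⟨(0, 0, 0, 0, 0, 0), by
      simp [SplitGens.std, biPow, (canonical s).w_zero]⟩
  refine eq_top_iff.2 fun z _ ↦ ?_
  have hz : z ∈ leftStabilizer (Submodule.span k (Set.range (canonical s).std)) :=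
    leftStabilizer_span_range_std s ▸ Algebra.mem_top
  simpa only [mul_one] using hz 1 one_mem

end Std

open TwistedAlg

/-- The lattice of exponents of `φ, ψ, b, c, K, a`, in this order, ordered lexicographically. -/
abbrev Lat : Type := Lex (Fin 6 → ℤ)

/-- The vector of the exponents of `φ, ψ, b, c, K, a`. -/
def vec (n m i l r t : ℤ) : Lat := toLex ![n, m, i, l, r, t]

section Lattice

variable {n m i l r t n' m' i' l' r' t' : ℤ}

lemma exists_vec (v : Lat) : ∃ n m i l r t, v = vec n m i l r t := by
  refine ⟨v 0, v 1, v 2, v 3, v 4, v 5, ofLex.injective ?_⟩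
  ext j
  fin_cases j <;> rfl

lemma vec_inj (h : vec n m i l r t = vec n' m' i' l' r' t') :
    n = n' ∧ m = m' ∧ i = i' ∧ l = l' ∧ r = r' ∧ t = t' := by
  have h' := congrFun (congrArg ofLex h)
  exact ⟨h' 0, h' 1, h' 2, h' 3, h' 4, h' 5⟩

lemma vec_zero : vec 0 0 0 0 0 0 = 0 := by
  apply ofLex.injective
  ext j
  fin_cases j <;> rfl

variable (n m i l r t n' m' i' l' r' t') in
lemma vec_add : vec n m i l r t + vec n' m' i' l' r' t' =
    vec (n + n') (m + m') (i + i') (l + l') (r + r') (t + t') := by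
  apply ofLex.injective
  ext j
  fin_cases j <;> rfl

variable (n m i l r t) in
lemma nsmul_vec (j : ℕ) :
    j • vec n m i l r t = vec (j * n) (j * m) (j * i) (j * l) (j * r) (j * t) := by
  induction j with
  | zero => simp [vec_zero]
  | succ j ih => rw [succ_nsmul, ih, vec_add]; push_cast; simp only [add_mul, one_mul]

lemma vec_lt_of_fst_lt (h : n < n') : vec n m i l r t < vec n' m' i' l' r' t' :=
  ⟨0, fun j hj ↦ absurd hj (by omega), h⟩

lemma vec_lt_of_snd_lt (h : m < m') : vec n m i l r t < vec n m' i' l' r' t' :=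
  ⟨1, fun j hj ↦ by obtain rfl : j = 0 := by omega
                    rfl, h⟩

/-- The commutation form of `φ, ψ, b, c, K, a`. -/
def omega : Lat →+ Lat →+ ℤ :=
  AddMonoidHom.mk' (fun v ↦ AddMonoidHom.mk' (fun w ↦ v 5 * w 4 - v 4 * w 5 +
    2 * (v 2 * w 3 - v 3 * w 2) + 2 * (v 2 * w 0 - v 0 * w 2) + 2 * (v 1 * w 3 - v 3 * w 1))
    (fun w w' ↦ by simp only [show ∀ j, (w + w') j = w j + w' j from fun _ ↦ rfl]; ring))
    (fun v v' ↦ by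
      ext w
      simp only [AddMonoidHom.mk'_apply, AddMonoidHom.add_apply,
        show ∀ j, (v + v') j = v j + v' j from fun _ ↦ rfl]
      ring)

variable (n m i l r t n' m' i' l' r' t') in
lemma omega_vec : omega (vec n m i l r t) (vec n' m' i' l' r' t') = t * r' - r * t' +
    2 * (i * l' - l * i') + 2 * (i * n' - n * i') + 2 * (m * l' - l * m') := rfl

/-- The leading exponent of `std v` in a quantum torus in which `f` has the leading exponent of
`φ ^ j b⁻¹` and `e` that of `ψ c⁻¹`. -/
def stdLead (j : ℤ) : ℕ × ℕ × ℤ × ℤ × ℤ × ℤ → Lat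
  | (n, m, i, l, r, t) => vec (n + j * (-i).toNat) (m + (-l).toNat) i l r t

lemma stdLead_injective (j : ℤ) : Function.Injective (stdLead j) := by
  rintro ⟨n, m, i, l, r, t⟩ ⟨n', m', i', l', r', t'⟩ h
  obtain ⟨hn, hm, rfl, rfl, rfl, rfl⟩ := vec_inj h
  rw [add_left_inj, Nat.cast_inj] at hn hm
  rw [hn, hm]

end Lattice

section QuantumTorus

variable {k : Type*} [Field k] (s : kˣ)

/-- The quantum torus generated by `φ, ψ, b, c, K, a`. -/
abbrev QT : Type _ := TwistedAlg s omega

/-- The monomial with a given exponent vector. -/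
noncomputable def mono (n m i l r t : ℤ) : QT s := single (vec n m i l r t) 1

variable (n m i l r t : ℤ)

lemma isMonomial_mono : IsMonomial (mono s n m i l r t) (vec n m i l r t) :=
  isMonomial_single _ one_ne_zero

lemma mono_mul (n' m' i' l' r' t' : ℤ) : mono s n m i l r t * mono s n' m' i' l' r' t' =
    (s : k) ^ (t * r' - r * t' + 2 * (i * l' - l * i') + 2 * (i * n' - n * i') +
      2 * (m * l' - l * m')) •
      mono s (n + n') (m + m') (i + i') (l + l') (r + r') (t + t') := by
  rw [mono, mono, mono, single_mul_single, omega_vec, vec_add, mul_one, mul_one, single, single,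
    one_smul]

lemma mono_zero : mono s 0 0 0 0 0 0 = 1 := by rw [mono, vec_zero, one_def]

/-- The specializations `φ ↦ x φ`, `ψ ↦ y ψ` of `D_q` in the quantum torus: `f` and `e` go to
`b⁻¹ (1 - x φ)` and `c⁻¹ (1 - y ψ)`, up to the order of the factors. -/
noncomputable def torusGens (x y : k) : SplitGens s (QT s) where
  w r t := mono s 0 0 0 0 r t
  b := mono s 0 0 1 0 0 0
  f := mono s 0 0 (-1) 0 0 0 - (x * (s : k) ^ (-2 : ℤ)) • mono s 1 0 (-1) 0 0 0
  c := mono s 0 0 0 1 0 0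
  e := mono s 0 0 0 (-1) 0 0 - (y * (s : k) ^ (2 : ℤ)) • mono s 0 1 0 (-1) 0 0
  w_zero := mono_zero s
  w_mul r t r' t' := by simp [mono_mul]
  b_w r t := by simp [Commute, SemiconjBy, mono_mul]
  f_w r t := by simp [Commute, SemiconjBy, mono_mul, mul_sub, sub_mul]
  c_w r t := by simp [Commute, SemiconjBy, mono_mul]
  e_w r t := by simp [Commute, SemiconjBy, mono_mul, mul_sub, sub_mul]
  f_b := by
    have hs := s.ne_zero
    norm_num [mono_mul, mul_sub, sub_mul, mono_zero]
    match_scalars <;> field_simp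
    ring
  e_c := by
    have hs := s.ne_zero
    norm_num [mono_mul, mul_sub, sub_mul, mono_zero]
    match_scalars <;> field_simp
    ring
  b_c := by
    have hs := s.ne_zero
    norm_num [QCommute, mono_mul]
    match_scalars
    field_simp
  f_c := by
    have hs := s.ne_zero
    norm_num [QCommute, mono_mul, mul_sub, sub_mul]
    match_scalars <;> field_simp
  b_e := by
    have hs := s.ne_zero
    norm_num [QCommute, mono_mul, mul_sub, sub_mul]
    match_scalars <;> field_simp
  f_e := by
    have hs := s.ne_zero
    norm_num [QCommute, mono_mul, mul_sub, sub_mul]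
    match_scalars <;> field_simp

variable (x y : k)

lemma torusGens_phi : (torusGens s x y).phi = x • mono s 1 0 0 0 0 0 := by
  have hs := s.ne_zero
  norm_num [SplitGens.phi, torusGens, mono_mul, mul_sub, mono_zero]
  match_scalars
  field_simp

lemma torusGens_psi : (torusGens s x y).psi = y • mono s 0 1 0 0 0 0 := by
  have hs := s.ne_zero
  norm_num [SplitGens.psi, torusGens, mono_mul, mul_sub, mono_zero]
  match_scalars
  field_simp

lemma hasLead_f_one : HasLead (torusGens s 1 y).f (vec 1 0 (-1) 0 0 0) := by
  have h : (torusGens s 1 y).f =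
      (-(s : k) ^ (-2 : ℤ)) • mono s 1 0 (-1) 0 0 0 + mono s 0 0 (-1) 0 0 0 := by
    simp only [torusGens, one_mul]
    module
  rw [h]
  exact ((isMonomial_mono s ..).smul (neg_ne_zero.2 (zpow_ne_zero _ s.ne_zero))).hasLead.add_of_lt
    (isMonomial_mono s ..).hasLead (vec_lt_of_fst_lt one_pos)

lemma isMonomial_f_zero : IsMonomial (torusGens s 0 y).f (vec 0 0 (-1) 0 0 0) := by
  simpa only [torusGens, zero_mul, zero_smul, sub_zero] using isMonomial_mono s 0 0 (-1) 0 0 0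

lemma hasLead_e_one : HasLead (torusGens s x 1).e (vec 0 1 0 (-1) 0 0) := by
  have h : (torusGens s x 1).e =
      (-(s : k) ^ (2 : ℤ)) • mono s 0 1 0 (-1) 0 0 + mono s 0 0 0 (-1) 0 0 := by
    simp only [torusGens, one_mul]
    module
  rw [h]
  exact ((isMonomial_mono s ..).smul (neg_ne_zero.2 (zpow_ne_zero _ s.ne_zero))).hasLead.add_of_lt
    (isMonomial_mono s ..).hasLead (vec_lt_of_snd_lt one_pos)

variable {s x} in
lemma hasLead_std {n m : ℕ} {i l r t j : ℤ}
    (hphi : HasLead ((torusGens s x 1).phi ^ n) (vec n 0 0 0 0 0))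
    (hf : HasLead (torusGens s x 1).f (vec j 0 (-1) 0 0 0)) :
    HasLead ((torusGens s x 1).std (n, m, i, l, r, t)) (stdLead j (n, m, i, l, r, t)) := by
  have hpsi : HasLead (torusGens s x 1).psi (vec 0 1 0 0 0 0) := by
    rw [torusGens_psi, one_smul]
    exact (isMonomial_mono s ..).hasLead
  have hw : HasLead ((torusGens s x 1).w r t) (vec 0 0 0 0 r t) :=
    (isMonomial_mono s ..).hasLead
  have hb : HasLead (torusGens s x 1).b (vec 0 0 1 0 0 0) := (isMonomial_mono s ..).hasLead
  have hc : HasLead (torusGens s x 1).c (vec 0 0 0 1 0 0) := (isMonomial_mono s ..).hasLead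
  have he := hasLead_e_one s x
  have h := (hw.mul (hphi.mul (hpsi.pow m))).mul
    (((hb.pow i.toNat).mul (hf.pow (-i).toNat)).mul ((hc.pow l.toNat).mul (he.pow (-l).toNat)))
  simp only [nsmul_vec, vec_add, mul_zero, mul_one, mul_neg, add_zero, zero_add, ← sub_eq_add_neg,
    Int.toNat_sub_toNat_neg] at h
  rwa [stdLead, mul_comm j, SplitGens.std, biPow, biPow]

end QuantumTorus

section PrimeIdeals

variable {R : Type*} [Ring R]

lemma isMin_primeSpec_iff (hbot : IsPrimeIdeal (⊥ : TwoSidedIdeal R)) {P : PrimeSpec R} :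
    IsMin P ↔ P.1 = ⊥ :=
  ⟨fun h ↦ le_bot_iff.1 (h (b := ⟨⊥, hbot⟩) (bot_le (a := P.1))), fun h Q _ ↦
    h.trans_le (bot_le (a := Q.1))⟩

lemma isHeightOnePrime_iff_minimal (hbot : IsPrimeIdeal (⊥ : TwoSidedIdeal R))
    {P : TwoSidedIdeal R} :
    IsHeightOnePrime P ↔ Minimal (fun Q ↦ IsPrimeIdeal Q ∧ Q ≠ ⊥) P := by
  have height_eq_one_iff (hP : IsPrimeIdeal P) : Order.height (⟨P, hP⟩ : PrimeSpec R) = 1 ↔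
      Minimal (fun Q : PrimeSpec R ↦ Q.1 ≠ ⊥) ⟨P, hP⟩ := by
    rw [← Nat.cast_one, Order.height_eq_coe_iff_minimal_le_height]
    simp only [Nat.cast_one, Order.one_le_iff_pos, pos_iff_ne_zero, ne_eq, Order.height_eq_zero,
      isMin_primeSpec_iff hbot]
  constructor
  · rintro ⟨hP, hheight⟩
    have hmin := (height_eq_one_iff hP).1 hheight
    exact ⟨⟨hP, hmin.prop⟩, fun Q hQ hle ↦ hmin.2 (y := ⟨Q, hQ.1⟩) hQ.2 hle⟩
  · intro hmin
    exact ⟨hmin.prop.1, (height_eq_one_iff hmin.prop.1).2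
      ⟨hmin.prop.2, fun Q hQ hle ↦ hmin.2 ⟨Q.2, hQ⟩ hle⟩⟩

lemma isHeightOnePrime_iff_eq_or_eq {I J : TwoSidedIdeal R}
    (hbot : IsPrimeIdeal (⊥ : TwoSidedIdeal R)) (hI : IsPrimeIdeal I) (hJ : IsPrimeIdeal J)
    (hIJ : ¬ I ≤ J) (hJI : ¬ J ≤ I) (hle : ∀ P, IsPrimeIdeal P → P ≠ ⊥ → I ≤ P ∨ J ≤ P)
    {P : TwoSidedIdeal R} : IsHeightOnePrime P ↔ P = I ∨ P = J := by
  have hI0 : I ≠ ⊥ := fun h ↦ hIJ (h ▸ bot_le)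
  have hJ0 : J ≠ ⊥ := fun h ↦ hJI (h ▸ bot_le)
  rw [isHeightOnePrime_iff_minimal hbot]
  constructor
  · intro hP
    exact (hle P hP.prop.1 hP.prop.2).imp (fun h ↦ (hP.eq_of_le ⟨hI, hI0⟩ h).symm)
      (fun h ↦ (hP.eq_of_le ⟨hJ, hJ0⟩ h).symm)
  · rintro (rfl | rfl)
    · exact ⟨⟨hI, hI0⟩, fun Q hQ hQI ↦
        (hle Q hQ.1 hQ.2).resolve_right fun h ↦ hJI (h.trans hQI)⟩
    · exact ⟨⟨hJ, hJ0⟩, fun Q hQ hQJ ↦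
        (hle Q hQ.1 hQ.2).resolve_left fun h ↦ hIJ (h.trans hQJ)⟩

lemma isPrimeIdeal_of_map_eq_zero_iff {S : Type*} [Ring S] [Nontrivial S] [NoZeroDivisors S]
    (f : R →+* S) {I : TwoSidedIdeal R} (h : ∀ y, f y = 0 ↔ y ∈ I) : IsPrimeIdeal I := by
  constructor
  · rintro rfl
    exact one_ne_zero ((map_one f).symm.trans ((h 1).2 trivial))
  · intro y z hyz
    have hmul := (h _).2 (hyz 1)
    rw [mul_one, map_mul] at hmul
    rw [← h, ← h]
    exact mul_eq_zero.1 hmul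

lemma IsPrimeIdeal.mem_or_mem_of_pow_mul_mem {P : TwoSidedIdeal R} (hP : IsPrimeIdeal P) {y z : R}
    (hy : ∀ r, ∃ r', y * r = r' * y) {n : ℕ} (h : y ^ n * z ∈ P) : y ∈ P ∨ z ∈ P := by
  induction n with
  | zero => right; simpa using h
  | succ n ih =>
    refine (hP.2 y (y ^ n * z) fun r ↦ ?_).elim .inl ih
    obtain ⟨r', hr⟩ := hy r
    rw [hr, mul_assoc, ← mul_assoc y, ← pow_succ']
    exact P.mul_mem_left _ _ h

end PrimeIdeals

section Algebra

variable {k A : Type*} [Field k] [Ring A] [Algebra k A] {I : TwoSidedIdeal A}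

/-- The elements `r` for which `y r` is a left multiple of `y`. -/
def normalizing (k : Type*) [Field k] [Algebra k A] (y : A) : Subalgebra k A where
  carrier := {r | ∃ r', y * r = r' * y}
  mul_mem' := by
    rintro r r₁ ⟨r', h⟩ ⟨r₁', h₁⟩
    exact ⟨r' * r₁', by rw [← mul_assoc, h, mul_assoc, h₁, mul_assoc]⟩
  add_mem' := by
    rintro r r₁ ⟨r', h⟩ ⟨r₁', h₁⟩
    exact ⟨r' + r₁', by rw [mul_add, h, h₁, add_mul]⟩
  algebraMap_mem' c := ⟨algebraMap k A c, (Algebra.commutes c y).symm⟩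

lemma mem_normalizing_of_commute {y r : A} (h : Commute y r) : r ∈ normalizing k y := ⟨r, h⟩

lemma QCommute.mem_normalizing {s : kˣ} {n : ℤ} {y r : A} (h : QCommute s n r y) :
    r ∈ normalizing k y :=
  ⟨(s : k) ^ (-n) • r, by rw [smul_mul_assoc]; exact h.symm⟩

lemma smul_mem_of_mem (c : k) {y : A} (hy : y ∈ I) : c • y ∈ I :=
  (I.asIdeal.restrictScalars k).smul_mem c hy

lemma smul_mem_iff {c : k} (hc : c ≠ 0) {y : A} : c • y ∈ I ↔ y ∈ I :=
  (I.asIdeal.restrictScalars k).smul_mem_iff hc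

lemma span_smul_isUnit_mul {c : k} (hc : c ≠ 0) {u : A} (hu : IsUnit u) (y : A) :
    TwoSidedIdeal.span {c • (u * y)} = TwoSidedIdeal.span {y} := by
  obtain ⟨u, rfl⟩ := hu
  apply le_antisymm <;> rw [TwoSidedIdeal.span_le, Set.singleton_subset_iff, SetLike.mem_coe]
  · exact smul_mem_of_mem c (TwoSidedIdeal.mul_mem_left _ _ _ (TwoSidedIdeal.subset_span rfl))
  · have hmem := (smul_mem_iff hc).1 (TwoSidedIdeal.subset_span (Set.mem_singleton (c • (↑u * y))))
    simpa only [Units.inv_mul_cancel_left] using TwoSidedIdeal.mul_mem_left _ (↑u⁻¹ : A) _ hmem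

lemma map_mem_span_singleton {R S : Type*} [Ring R] [Ring S] (f : R →+* S) {y z : R}
    (hz : z ∈ TwoSidedIdeal.span {y}) : f z ∈ TwoSidedIdeal.span {f y} :=
  (TwoSidedIdeal.mem_comap f).1 (TwoSidedIdeal.span_le.2 (Set.singleton_subset_iff.2
    ((TwoSidedIdeal.mem_comap f).2 (TwoSidedIdeal.subset_span (Set.mem_singleton _)))) hz)

lemma mem_span_singleton_iff_of_equiv {B : Type*} [Ring B] [Algebra k B] (e : A ≃ₐ[k] B)
    {y z : A} : e z ∈ TwoSidedIdeal.span {e y} ↔ z ∈ TwoSidedIdeal.span {y} := by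
  refine ⟨fun h ↦ ?_, map_mem_span_singleton (e : A →+* B)⟩
  simpa using map_mem_span_singleton (e.symm : B →+* A) h

lemma mul_pow_succ_of_mul_eq {y z : A} {c : k} (h : z * y = c • (y * z) + (1 - c) • 1) (n : ℕ) :
    z * y ^ (n + 1) = c ^ (n + 1) • (y ^ (n + 1) * z) + (1 - c ^ (n + 1)) • y ^ n := by
  induction n with
  | zero => simpa using h
  | succ n ih =>
    rw [pow_succ, ← mul_assoc, ih, add_mul, smul_mul_assoc, mul_assoc, h, mul_add, mul_smul_comm,
      mul_smul_comm, mul_one, smul_mul_assoc, ← pow_succ, ← mul_assoc, ← pow_succ]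
    module

/-- Commuting with `z` lowers the exponent of `y` in a product `y ^ n u`, when `z` and `u` commute
up to a scalar. -/
lemma mem_of_pow_mul_mem {s : kˣ} [Generic s] {N M : ℤ} (hN : N ≠ 0) {y z u : A}
    (h : z * y = (s : k) ^ N • (y * z) + (1 - (s : k) ^ N) • 1) (hu : QCommute s M u z) {n : ℕ}
    (hI : y ^ n * u ∈ I) : u ∈ I := by
  induction n with
  | zero => simpa using hI
  | succ n ih =>
    apply ih
    have hpow : 1 - ((s : k) ^ N) ^ (n + 1) ≠ 0 := by
      rw [← zpow_natCast, ← zpow_mul, ← zpow_zero (s : k)]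
      exact Generic.zpow_sub_zpow_ne_zero s (by positivity)
    have key : (1 - ((s : k) ^ N) ^ (n + 1)) • (y ^ n * u) = z * (y ^ (n + 1) * u) -
        (((s : k) ^ N) ^ (n + 1) * (s : k) ^ (-M)) • (y ^ (n + 1) * u * z) := by
      rw [← mul_assoc z, mul_pow_succ_of_mul_eq h, mul_assoc _ u, hu, mul_smul_comm, smul_smul,
        mul_assoc _ ((s : k) ^ (-M)), ← zpow_add₀ s.ne_zero, neg_add_cancel, zpow_zero, mul_one,
        add_mul, smul_mul_assoc, smul_mul_assoc, mul_assoc, add_sub_cancel_left]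
    rw [← smul_mem_iff hpow, key]
    exact I.sub_mem (I.mul_mem_left _ _ hI) (smul_mem_of_mem _ (I.mul_mem_right _ _ hI))

end Algebra

/-- If the elements of `A` that are monomials in a twisted group algebra separate the exponents,
commuting with them strips an element of an ideal down to a single monomial. -/
lemma exists_isMonomial_mem {k G A : Type*} [Field k] [AddCommGroup G] [Ring A] [Algebra k A]
    {s : kˣ} {ω : G →+ G →+ ℤ} (f : A →ₐ[k] TwistedAlg s ω)
    (hsep : ∀ v v', v ≠ v' → ∃ g u, IsMonomial (f g) u ∧
      (s : k) ^ (ω v' u - ω u v') ≠ (s : k) ^ (ω v u - ω u v))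
    {I : TwoSidedIdeal A} {y : A} (hy : y ∈ I) (hfy : f y ≠ 0) :
    ∃ z ∈ I, ∃ g, IsMonomial (f z) g := by
  induction hN : (f y).support.card using Nat.strong_induction_on generalizing y with | _ N ih
  obtain ⟨v, hv⟩ := support_nonempty hfy
  rw [mem_support] at hv
  by_cases hall : ∀ v', coeff v' (f y) ≠ 0 → v' = v
  · exact ⟨y, hy, v, _, hv, eq_single_of_forall_coeff hall⟩
  push Not at hall
  obtain ⟨v', hv', hne⟩ := hall
  obtain ⟨g, u, hg, hu⟩ := hsep v v' hne.symm
  have map_comm : f (y * g - (s : k) ^ (ω v u - ω u v) • (g * y)) =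
      f y * f g - (s : k) ^ (ω v u - ω u v) • (f g * f y) := by
    rw [map_sub, map_smul, map_mul, map_mul]
  refine ih _ ?_ (I.sub_mem (I.mul_mem_right _ _ hy) (smul_mem_of_mem _ (I.mul_mem_left g _ hy)))
    ?_ (congrArg (fun z ↦ z.support.card) map_comm)
  · exact hN ▸ card_support_mul_sub_smul_mul_lt hg hv
  · intro h0
    have hcoeff := (coeff_mul_sub_smul_mul_ne_zero_iff hg).2 ⟨hu, hv'⟩
    rw [← map_comm, h0, map_zero] at hcoeff
    exact hcoeff rfl

/-! ### The embedding in a quantum torus -/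

section Embedding

variable {k : Type*} [Field k] (s : kˣ) [Generic s]

/-- The embedding of `D_q` in the quantum torus generated by `φ`, `ψ`, `b`, `c`, `K` and `a`. -/
noncomputable def emb : D k (s ^ 2) →ₐ[k] QT s := (torusGens s 1 1).lift

lemma emb_W (r t : ℤ) : emb s (W s r t) = mono s 0 0 0 0 r t := SplitGens.lift_W _ r t

lemma emb_b : emb s (canonical s).b = mono s 0 0 1 0 0 0 := SplitGens.lift_b _

lemma emb_c : emb s (canonical s).c = mono s 0 0 0 1 0 0 := SplitGens.lift_c _

lemma emb_phi : emb s (canonical s).phi = mono s 1 0 0 0 0 0 := by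
  rw [emb, SplitGens.lift_phi, torusGens_phi, one_smul]

lemma emb_psi : emb s (canonical s).psi = mono s 0 1 0 0 0 0 := by
  rw [emb, SplitGens.lift_psi, torusGens_psi, one_smul]

lemma hasLead_emb_std (v : ℕ × ℕ × ℤ × ℤ × ℤ × ℤ) :
    HasLead (emb s ((canonical s).std v)) (stdLead 1 v) := by
  obtain ⟨n, m, i, l, r, t⟩ := v
  rw [emb, SplitGens.lift_std]
  refine hasLead_std ?_ (hasLead_f_one s 1)
  simpa only [torusGens_phi, one_smul, nsmul_vec, mul_zero, mul_one] using
    (isMonomial_mono s 1 0 0 0 0 0).hasLead.pow n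

variable {s} in
lemma exists_hasLead_emb {y : D k (s ^ 2)} (hy : y ≠ 0) : ∃ v, HasLead (emb s y) (stdLead 1 v) :=
  exists_hasLead_of_mem_span (emb s).toLinearMap (stdLead_injective 1) (hasLead_emb_std s)
    (span_range_std s ▸ Submodule.mem_top) hy

lemma emb_injective : Function.Injective (emb s) := by
  refine (injective_iff_map_eq_zero _).2 fun y hy ↦ ?_
  by_contra hne
  obtain ⟨v, hv⟩ := exists_hasLead_emb hne
  exact hv.ne_zero hy

lemma noZeroDivisors_D : NoZeroDivisors (D k (s ^ 2)) :=
  (emb_injective s).noZeroDivisors (emb s) (map_zero _) (map_mul _)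

variable {s}

lemma exists_eq_smul_of_emb_isMonomial {y z : D k (s ^ 2)} {g : Lat} (hy : IsMonomial (emb s y) g)
    (hz : IsMonomial (emb s z) g) : ∃ c : k, c ≠ 0 ∧ y = c • z := by
  obtain ⟨c, hc, h⟩ := hy.exists_eq_smul hz
  exact ⟨c, hc, emb_injective s (by rw [h, map_smul])⟩

lemma exists_eq_smul_W_of_mul_eq_one {u v : D k (s ^ 2)} (huv : u * v = 1) :
    ∃ (c : k) (r t : ℤ), c ≠ 0 ∧ u = c • W s r t := by
  have emb_mul : emb s u * emb s v = 1 := by rw [← map_mul, huv, map_one]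
  obtain ⟨g, hg⟩ := exists_isMonomial_of_mul_eq_one emb_mul
  have hne : emb s u * emb s v ≠ 0 := by
    rw [emb_mul, ← mono_zero]
    exact (isMonomial_mono s ..).hasLead.ne_zero
  -- the leading exponents of `u` and `v` add up to `0`, and they have no negative `φ`- and
  -- `ψ`-components
  obtain ⟨⟨n, m, i, l, r, t⟩, hu⟩ := exists_hasLead_emb
    (ne_zero_of_map (f := emb s) (left_ne_zero_of_mul hne))
  obtain ⟨⟨n', m', i', l', r', t'⟩, hv⟩ := exists_hasLead_emb
    (ne_zero_of_map (f := emb s) (right_ne_zero_of_mul hne))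
  have lead_add := (emb_mul ▸ hu.mul hv).unique isMonomial_one.hasLead
  rw [stdLead, stdLead, vec_add, ← vec_zero] at lead_add
  obtain ⟨hn, hm, hi, hl, -, -⟩ := vec_inj lead_add
  have lead_eq : stdLead 1 (n, m, i, l, r, t) = vec 0 0 0 0 r t := by
    rw [stdLead]
    congr 1 <;> omega
  rw [hg.hasLead.unique hu, lead_eq] at hg
  obtain ⟨c, hc, h⟩ := exists_eq_smul_of_emb_isMonomial hg (emb_W s r t ▸ isMonomial_mono s ..)
  exact ⟨c, r, t, hc, h⟩

lemma nonneg_of_coeff_emb_ne_zero {y : D k (s ^ 2)} {n m i l r t : ℤ}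
    (h : coeff (vec n m i l r t) (emb s y) ≠ 0) : 0 ≤ n ∧ 0 ≤ m := by
  let S : AddSubmonoid Lat :=
    { carrier := {v | 0 ≤ v 0 ∧ 0 ≤ v 1}
      zero_mem' := ⟨le_rfl, le_rfl⟩
      add_mem' := fun hv hw ↦ ⟨add_nonneg hv.1 hw.1, add_nonneg hv.2 hw.2⟩ }
  have mono_mem {n m i l r t : ℤ} (hn : 0 ≤ n) (hm : 0 ≤ m) : mono s n m i l r t ∈ supported S :=
    (isMonomial_mono s ..).mem_supported ⟨hn, hm⟩
  have comap_eq_top : (supported S).comap (emb s) = ⊤ := by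
    refine eq_top_of_canonical_mem _ (fun r t ↦ ?_) ?_ ?_ ?_ ?_
    · exact (Subalgebra.mem_comap ..).2 (emb_W s r t ▸ mono_mem le_rfl le_rfl)
    · exact (Subalgebra.mem_comap ..).2 (emb_b s ▸ mono_mem le_rfl le_rfl)
    · rw [Subalgebra.mem_comap, emb, SplitGens.lift_f]
      exact sub_mem (mono_mem le_rfl le_rfl) (Subalgebra.smul_mem _ (mono_mem zero_le_one le_rfl) _)
    · exact (Subalgebra.mem_comap ..).2 (emb_c s ▸ mono_mem le_rfl le_rfl)
    · rw [Subalgebra.mem_comap, emb, SplitGens.lift_e]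
      exact sub_mem (mono_mem le_rfl le_rfl) (Subalgebra.smul_mem _ (mono_mem le_rfl zero_le_one) _)
  exact (comap_eq_top ▸ Algebra.mem_top : y ∈ (supported S).comap (emb s)) _ h

lemma exists_separating {v v' : Lat} (hne : v ≠ v') : ∃ (g : D k (s ^ 2)) (u : Lat),
    IsMonomial (emb s g) u ∧
      (s : k) ^ (omega v' u - omega u v') ≠ (s : k) ^ (omega v u - omega u v) := by
  obtain ⟨n, m, i, l, r, t, rfl⟩ := exists_vec v
  obtain ⟨n', m', i', l', r', t', rfl⟩ := exists_vec v'
  by_contra! h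
  have separate {g : D k (s ^ 2)} {n m i l r t} (hg : emb s g = mono s n m i l r t) :=
    Generic.zpow_injective s (h g _ (hg ▸ isMonomial_mono s n m i l r t))
  have hK := separate (emb_W s 1 0)
  have ha := separate (emb_W s 0 1)
  have hb := separate (emb_b s)
  have hc := separate (emb_c s)
  have hphi := separate (emb_phi s)
  have hpsi := separate (emb_psi s)
  simp only [omega_vec] at hK ha hb hc hphi hpsi
  apply hne
  congr 1 <;> omega

end Embedding

/-! ### Height one primes -/

section HeightOnePrimes

variable {k : Type*} [Field k] (s : kˣ) [Generic s]

lemma isMonomial_emb_W_mul (n m i l : ℕ) (r t : ℤ) :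
    IsMonomial (emb s (W s r t * ((canonical s).b ^ i * ((canonical s).c ^ l *
      ((canonical s).phi ^ n * (canonical s).psi ^ m))))) (vec n m i l r t) := by
  have h := (isMonomial_mono s 0 0 0 0 r t).mul (((isMonomial_mono s 0 0 1 0 0 0).pow i).mul
    (((isMonomial_mono s 0 0 0 1 0 0).pow l).mul
      (((isMonomial_mono s 1 0 0 0 0 0).pow n).mul ((isMonomial_mono s 0 1 0 0 0 0).pow m))))
  simpa only [map_mul, map_pow, emb_W, emb_b, emb_c, emb_phi, emb_psi, nsmul_vec, vec_add, mul_zero,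
    mul_one, zero_add, add_zero] using h

variable {s}

lemma exists_pow_mul_mem {I : TwoSidedIdeal (D k (s ^ 2))} (hI : I ≠ ⊥) :
    ∃ n m i l : ℕ, (canonical s).b ^ i * ((canonical s).c ^ l *
      ((canonical s).phi ^ n * (canonical s).psi ^ m)) ∈ I := by
  obtain ⟨y, hy, hy0⟩ : ∃ y ∈ I, y ≠ 0 := by
    by_contra! h
    exact hI (eq_bot_iff.2 fun y hy ↦ (TwoSidedIdeal.mem_bot _).2 (h y hy))
  obtain ⟨z, hz, g, hzg⟩ := exists_isMonomial_mem (emb s) (fun _ _ ↦ exists_separating) hy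
    ((map_ne_zero_iff _ (emb_injective s)).2 hy0)
  obtain ⟨n, m, i, l, r, t, rfl⟩ := exists_vec g
  have h := hzg.mul (isMonomial_emb_W_mul s n.natAbs m.natAbs i.natAbs l.natAbs (-r) (-t))
  rw [← map_mul, vec_add] at h
  have hvec : vec (n + n.natAbs) (m + m.natAbs) (i + i.natAbs) (l + l.natAbs) (r + -r) (t + -t) =
      vec (n + n.natAbs).toNat (m + m.natAbs).toNat (i + i.natAbs).toNat (l + l.natAbs).toNat 0 0 :=
    by congr 1 <;> omega
  rw [hvec] at h
  obtain ⟨c, hc, heq⟩ := exists_eq_smul_of_emb_isMonomial h (isMonomial_emb_W_mul s ..)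
  rw [W_zero, one_mul] at heq
  exact ⟨_, _, _, _, (smul_mem_iff hc).1 (heq ▸ I.mul_mem_right _ _ hz)⟩

lemma exists_phi_pow_mul_psi_pow_mem {I : TwoSidedIdeal (D k (s ^ 2))} (hI : I ≠ ⊥) :
    ∃ n m : ℕ, (canonical s).phi ^ n * (canonical s).psi ^ m ∈ I := by
  obtain ⟨n, m, i, l, h⟩ := exists_pow_mul_mem hI
  have f_comm := ((canonical s).f_c.pow_right l).mul_right
    (((canonical s).qCommute_f_phi.pow_right n).mul_right
      ((qCommute_zero.2 (canonical s).commute_psi_f.symm).pow_right m))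
  have e_comm := ((qCommute_zero.2 (canonical s).commute_phi_e.symm).pow_right n).mul_right
    ((canonical s).qCommute_e_psi.pow_right m)
  exact ⟨n, m, mem_of_pow_mul_mem (by norm_num) (canonical s).e_c e_comm.symm
    (mem_of_pow_mul_mem (by norm_num) (canonical s).f_b f_comm.symm h)⟩

variable (s)

lemma exists_phi_mul_eq (r : D k (s ^ 2)) :
    ∃ r', (canonical s).phi * r = r' * (canonical s).phi := by
  have h : normalizing k (canonical s).phi = ⊤ :=
    eq_top_of_canonical_mem _
      (fun r t ↦ mem_normalizing_of_commute ((canonical s).commute_phi_w r t))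
      (canonical s).qCommute_b_phi.mem_normalizing (canonical s).qCommute_f_phi.mem_normalizing
      (mem_normalizing_of_commute (canonical s).commute_phi_c)
      (mem_normalizing_of_commute (canonical s).commute_phi_e)
  exact (h ▸ Algebra.mem_top : r ∈ normalizing k (canonical s).phi)

lemma exists_psi_mul_eq (r : D k (s ^ 2)) :
    ∃ r', (canonical s).psi * r = r' * (canonical s).psi := by
  have h : normalizing k (canonical s).psi = ⊤ :=
    eq_top_of_canonical_mem _
      (fun r t ↦ mem_normalizing_of_commute ((canonical s).commute_psi_w r t))
      (mem_normalizing_of_commute (canonical s).commute_psi_b)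
      (mem_normalizing_of_commute (canonical s).commute_psi_f)
      (canonical s).qCommute_c_psi.mem_normalizing (canonical s).qCommute_e_psi.mem_normalizing
  exact (h ▸ Algebra.mem_top : r ∈ normalizing k (canonical s).psi)

variable {s} in
lemma span_le_of_isPrimeIdeal {P : TwoSidedIdeal (D k (s ^ 2))} (hP : IsPrimeIdeal P)
    (hP0 : P ≠ ⊥) : TwoSidedIdeal.span {(canonical s).phi} ≤ P ∨
      TwoSidedIdeal.span {(canonical s).psi} ≤ P := by
  obtain ⟨n, m, h⟩ := exists_phi_pow_mul_psi_pow_mem hP0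
  simp only [TwoSidedIdeal.span_le, Set.singleton_subset_iff, SetLike.mem_coe]
  refine (hP.mem_or_mem_of_pow_mul_mem (exists_phi_mul_eq s) h).imp_right fun h ↦ ?_
  rw [← mul_one (_ ^ m)] at h
  refine (hP.mem_or_mem_of_pow_mul_mem (exists_psi_mul_eq s) h).resolve_right fun h ↦ ?_
  exact hP.1 ((TwoSidedIdeal.one_mem_iff P).1 h)

instance : Nontrivial (QT s) :=
  ⟨_, _, (isMonomial_one (s := s) (ω := omega)).hasLead.ne_zero⟩

lemma isPrimeIdeal_bot : IsPrimeIdeal (⊥ : TwoSidedIdeal (D k (s ^ 2))) :=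
  isPrimeIdeal_of_map_eq_zero_iff (emb s : D k (s ^ 2) →+* QT s) fun y ↦ by
    rw [TwoSidedIdeal.mem_bot]
    exact map_eq_zero_iff (emb s) (emb_injective s)

lemma exists_sub_mem_span_phi (y : D k (s ^ 2)) :
    ∃ z ∈ Submodule.span k (Set.range fun v ↦ (canonical s).std (0, v)),
      y - z ∈ TwoSidedIdeal.span {(canonical s).phi} := by
  have hy : y ∈ Submodule.span k (Set.range (canonical s).std) :=
    span_range_std s ▸ Submodule.mem_top
  induction hy using Submodule.span_induction with
  | mem _ h =>
    obtain ⟨⟨n, m, i, l, r, t⟩, rfl⟩ := h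
    cases n with
    | zero => exact ⟨_, Submodule.subset_span ⟨_, rfl⟩, by rw [sub_self]; exact zero_mem _⟩
    | succ n =>
      refine ⟨0, zero_mem _, ?_⟩
      rw [sub_zero, ← SplitGens.phi_mul_std]
      exact TwoSidedIdeal.mul_mem_right _ _ _ (TwoSidedIdeal.subset_span (Set.mem_singleton _))
  | zero => exact ⟨0, zero_mem _, by rw [sub_zero]; exact zero_mem _⟩
  | add _ _ _ _ hy hy' =>
    obtain ⟨z, hz, h⟩ := hy
    obtain ⟨z', hz', h'⟩ := hy'
    exact ⟨z + z', add_mem hz hz', by rw [add_sub_add_comm]; exact add_mem h h'⟩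
  | smul c _ _ hy =>
    obtain ⟨z, hz, h⟩ := hy
    exact ⟨c • z, Submodule.smul_mem _ c hz, by rw [← smul_sub]; exact smul_mem_of_mem c h⟩

lemma lift_torusGens_eq_zero_iff {y : D k (s ^ 2)} :
    (torusGens s 0 1).lift y = 0 ↔ y ∈ TwoSidedIdeal.span {(canonical s).phi} := by
  have lift_eq_zero {y : D k (s ^ 2)} (hy : y ∈ TwoSidedIdeal.span {(canonical s).phi}) :
      (torusGens s 0 1).lift y = 0 := by
    have h := map_mem_span_singleton ((torusGens s 0 1).lift : D k (s ^ 2) →+* QT s) hy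
    change (torusGens s 0 1).lift y ∈
      TwoSidedIdeal.span {(torusGens s 0 1).lift (canonical s).phi} at h
    rw [SplitGens.lift_phi, torusGens_phi, zero_smul] at h
    exact (TwoSidedIdeal.mem_bot _).1 (TwoSidedIdeal.span_le.2 (by simp) h)
  refine ⟨fun h ↦ ?_, lift_eq_zero⟩
  obtain ⟨z, hz, hyz⟩ := exists_sub_mem_span_phi s y
  have lift_z : (torusGens s 0 1).lift z = 0 := by
    rw [← h, ← sub_eq_zero, ← map_sub, ← neg_sub, map_neg, lift_eq_zero hyz, neg_zero]
  have hasLead_lift (v) : HasLead ((torusGens s 0 1).lift ((canonical s).std (0, v)))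
      (stdLead 0 (0, v)) := by
    rw [SplitGens.lift_std]
    refine hasLead_std ?_ (isMonomial_f_zero s 1).hasLead
    simpa only [pow_zero, map_one, mul_zero, Nat.cast_zero, vec_zero] using
      (isMonomial_one (s := s) (ω := omega)).hasLead
  have hz0 : z = 0 := by
    by_contra hne
    obtain ⟨v, hv⟩ := exists_hasLead_of_mem_span (torusGens s 0 1).lift.toLinearMap
      ((stdLead_injective 0).comp (Prod.mk_right_injective 0)) hasLead_lift hz hne
    exact hv.ne_zero lift_z
  rwa [hz0, sub_zero] at hyz

lemma isPrimeIdeal_span_phi : IsPrimeIdeal (TwoSidedIdeal.span {(canonical s).phi}) :=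
  isPrimeIdeal_of_map_eq_zero_iff ((torusGens s 0 1).lift : D k (s ^ 2) →+* QT s)
    fun _ ↦ lift_torusGens_eq_zero_iff s

lemma psi_notMem_span_phi : (canonical s).psi ∉ TwoSidedIdeal.span {(canonical s).phi} := by
  rw [← lift_torusGens_eq_zero_iff, SplitGens.lift_psi, torusGens_psi, one_smul]
  exact (isMonomial_mono s ..).hasLead.ne_zero

variable {s} {t : kˣ} [Generic t]

lemma lift_swap_comp_lift_swap (h : s * t = 1) (h' : t * s = 1) :
    ((canonical t).swap h').lift.comp ((canonical s).swap h).lift = AlgHom.id k (D k (t ^ 2)) := by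
  refine algHom_ext_canonical (fun i j ↦ ?_) ?_ ?_ ?_ ?_ <;> rw [AlgHom.comp_apply]
  · rw [SplitGens.lift_W]
    exact SplitGens.lift_W _ j i
  · rw [SplitGens.lift_b]
    exact SplitGens.lift_c _
  · rw [SplitGens.lift_f]
    exact SplitGens.lift_e _
  · rw [SplitGens.lift_c]
    exact SplitGens.lift_b _
  · rw [SplitGens.lift_e]
    exact SplitGens.lift_f _

/-- The isomorphism that reflects the symmetry of the relations under `SplitGens.swap`. -/
noncomputable def swapEquiv (h : s * t = 1) : D k (s ^ 2) ≃ₐ[k] D k (t ^ 2) :=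
  have h' := mul_comm s t ▸ h
  AlgEquiv.ofAlgHom ((canonical t).swap h').lift ((canonical s).swap h).lift
    (lift_swap_comp_lift_swap h h') (lift_swap_comp_lift_swap h' h)

lemma swapEquiv_phi (h : s * t = 1) :
    swapEquiv h (canonical s).phi = (canonical t).psi :=
  SplitGens.lift_phi _

lemma swapEquiv_psi (h : s * t = 1) :
    swapEquiv h (canonical s).psi = (canonical t).phi :=
  SplitGens.lift_psi _

variable (s)

lemma isPrimeIdeal_span_psi : IsPrimeIdeal (TwoSidedIdeal.span {(canonical s).psi}) := by
  have : Generic s⁻¹ := .of_mul_eq_one (mul_inv_cancel s)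
  let e := swapEquiv (mul_inv_cancel s)
  refine isPrimeIdeal_of_map_eq_zero_iff
    ((torusGens s⁻¹ 0 1).lift.comp (e : D k (s ^ 2) →ₐ[k] _) : D k (s ^ 2) →+* QT s⁻¹) fun y ↦ ?_
  change (torusGens s⁻¹ 0 1).lift (e y) = 0 ↔ _
  rw [lift_torusGens_eq_zero_iff, ← swapEquiv_psi (mul_inv_cancel s),
    mem_span_singleton_iff_of_equiv]

lemma phi_notMem_span_psi : (canonical s).phi ∉ TwoSidedIdeal.span {(canonical s).psi} := by
  have : Generic s⁻¹ := .of_mul_eq_one (mul_inv_cancel s)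
  rw [← mem_span_singleton_iff_of_equiv (swapEquiv (mul_inv_cancel s)), swapEquiv_phi,
    swapEquiv_psi]
  exact psi_notMem_span_phi s⁻¹

lemma span_phi : TwoSidedIdeal.span {HeisenbergDouble.phi k (s ^ 2)} =
    TwoSidedIdeal.span {(canonical s).phi} := by
  rw [phi_eq, ← one_smul k (W s 0 1 * _)]
  exact span_smul_isUnit_mul one_ne_zero ((canonical s).wUnit 0 1).isUnit _

lemma span_psi : TwoSidedIdeal.span {HeisenbergDouble.psi k (s ^ 2)} =
    TwoSidedIdeal.span {(canonical s).psi} := by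
  rw [psi_eq]
  exact span_smul_isUnit_mul (zpow_ne_zero _ s.ne_zero) ((canonical s).wUnit 1 (-1)).isUnit _

theorem isHeightOnePrime_iff_eq_span (P : TwoSidedIdeal (D k (s ^ 2))) :
    IsHeightOnePrime P ↔ P = TwoSidedIdeal.span {HeisenbergDouble.phi k (s ^ 2)} ∨
      P = TwoSidedIdeal.span {HeisenbergDouble.psi k (s ^ 2)} := by
  rw [span_phi, span_psi]
  refine isHeightOnePrime_iff_eq_or_eq (isPrimeIdeal_bot s) (isPrimeIdeal_span_phi s)
    (isPrimeIdeal_span_psi s) (fun h ↦ ?_) (fun h ↦ ?_) fun _ ↦ span_le_of_isPrimeIdeal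
  · exact phi_notMem_span_psi s (h (TwoSidedIdeal.subset_span (Set.mem_singleton _)))
  · exact psi_notMem_span_phi s (h (TwoSidedIdeal.subset_span (Set.mem_singleton _)))

end HeightOnePrimes

namespace SplitGens

variable {k : Type*} [Field k] {s : kˣ} {B : Type*} [Ring B] [Algebra k B] (d : SplitGens s B)

/-- The split generators obtained by a symplectic substitution in the torus. -/
def twist (g : SL(2, ℤ)) : SplitGens s B where
  __ := d
  w r t := d.w (g.1 0 0 * r + g.1 0 1 * t) (g.1 1 0 * r + g.1 1 1 * t)
  w_zero := by simp only [mul_zero, add_zero, d.w_zero]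
  w_mul r t r' t' := by
    have hdet := g.2
    rw [Matrix.det_fin_two] at hdet
    rw [d.w_mul]
    congr 1
    · congr 1
      linear_combination (t * r' - r * t') * hdet
    · congr 1 <;> ring
  b_w _ _ := d.b_w _ _
  f_w _ _ := d.f_w _ _
  c_w _ _ := d.c_w _ _
  e_w _ _ := d.e_w _ _

/-- The split generators rescaled by `(α, β, x, y)`: the factors of `w 1 0`, `w 0 1`, `b` and `c`
are `α`, `β`, `x` and `y`. -/
def scale (u : Torus k) : SplitGens s B where
  w r t := ((u.1 ^ r * u.2.1 ^ t : kˣ) : k) • d.w r t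
  b := (u.2.2.1 : k) • d.b
  f := ((u.2.2.1⁻¹ : kˣ) : k) • d.f
  c := (u.2.2.2 : k) • d.c
  e := ((u.2.2.2⁻¹ : kˣ) : k) • d.e
  w_zero := by simp [d.w_zero]
  w_mul r t r' t' := by
    rw [smul_mul_smul_comm, d.w_mul, smul_comm, ← Units.val_mul, mul_mul_mul_comm, ← zpow_add,
      ← zpow_add]
  b_w r t := ((d.b_w r t).smul_left _).smul_right _
  f_w r t := ((d.f_w r t).smul_left _).smul_right _
  c_w r t := ((d.c_w r t).smul_left _).smul_right _
  e_w r t := ((d.e_w r t).smul_left _).smul_right _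
  f_b := by
    rw [smul_mul_smul_comm, smul_mul_smul_comm, Units.inv_mul, Units.mul_inv, one_smul, one_smul,
      d.f_b]
  e_c := by
    rw [smul_mul_smul_comm, smul_mul_smul_comm, Units.inv_mul, Units.mul_inv, one_smul, one_smul,
      d.e_c]
  b_c := (d.b_c.smul_left _).smul_right _
  f_c := (d.f_c.smul_left _).smul_right _
  b_e := (d.b_e.smul_left _).smul_right _
  f_e := (d.f_e.smul_left _).smul_right _

end SplitGens

/-! ### Automorphisms -/

section Automorphisms

variable {k : Type*} [Field k] (s : kˣ) [Generic s]

variable {s} in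
lemma algEquiv_ext_canonical {ρ τ : D k (s ^ 2) ≃ₐ[k] D k (s ^ 2)}
    (hw : ∀ r t, ρ (W s r t) = τ (W s r t)) (hb : ρ (canonical s).b = τ (canonical s).b)
    (hf : ρ (canonical s).f = τ (canonical s).f) (hc : ρ (canonical s).c = τ (canonical s).c)
    (he : ρ (canonical s).e = τ (canonical s).e) : ρ = τ :=
  AlgEquiv.coe_toAlgHom_injective (algHom_ext_canonical hw hb hf hc he)

lemma lift_twist_W (g : SL(2, ℤ)) (r t : ℤ) : ((canonical s).twist g).lift (W s r t) =
    W s (g.1 0 0 * r + g.1 0 1 * t) (g.1 1 0 * r + g.1 1 1 * t) :=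
  SplitGens.lift_W _ r t

lemma lift_scale_W (u : Torus k) (r t : ℤ) : ((canonical s).scale u).lift (W s r t) =
    ((u.1 ^ r * u.2.1 ^ t : kˣ) : k) • W s r t :=
  SplitGens.lift_W _ r t

/-- The action of `SL₂(ℤ)` on `D_q` by symplectic substitutions in the torus. -/
noncomputable def slAut : SL(2, ℤ) →* (D k (s ^ 2) ≃ₐ[k] D k (s ^ 2)) :=
  (AlgEquiv.algHomUnitsEquiv k (D k (s ^ 2))).toMonoidHom.comp <| MonoidHom.toHomUnits
    { toFun := fun g ↦ ((canonical s).twist g).lift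
      map_one' := by
        refine algHom_ext_canonical (fun r t ↦ ?_) ?_ ?_ ?_ ?_
        · rw [lift_twist_W]
          simp
        all_goals simp [SplitGens.twist]
      map_mul' := fun g h ↦ by
        refine algHom_ext_canonical (fun r t ↦ ?_) ?_ ?_ ?_ ?_
        · simp only [AlgHom.mul_apply, lift_twist_W, Matrix.SpecialLinearGroup.coe_mul,
            Matrix.mul_apply, Fin.sum_univ_two]
          congr 1 <;> ring
        all_goals simp [SplitGens.twist] }

/-- The diagonal action of the torus `(k*)⁴` on `D_q`. -/
noncomputable def diagAut : Torus k →* (D k (s ^ 2) ≃ₐ[k] D k (s ^ 2)) :=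
  (AlgEquiv.algHomUnitsEquiv k (D k (s ^ 2))).toMonoidHom.comp <| MonoidHom.toHomUnits
    { toFun := fun u ↦ ((canonical s).scale u).lift
      map_one' := by
        refine algHom_ext_canonical (fun r t ↦ ?_) ?_ ?_ ?_ ?_
        · rw [lift_scale_W]
          simp
        all_goals simp [SplitGens.scale]
      map_mul' := fun u v ↦ by
        refine algHom_ext_canonical (fun r t ↦ ?_) ?_ ?_ ?_ ?_
        · simp only [AlgHom.mul_apply, lift_scale_W, map_smul, smul_smul, ← Units.val_mul,
            Prod.fst_mul, Prod.snd_mul, mul_zpow]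
          congr 2
          ac_rfl
        all_goals simp [SplitGens.scale, smul_smul, mul_comm] }

variable (g : SL(2, ℤ)) (u : Torus k) (r t : ℤ)

lemma slAut_W : slAut s g (W s r t) =
    W s (g.1 0 0 * r + g.1 0 1 * t) (g.1 1 0 * r + g.1 1 1 * t) := lift_twist_W s g r t

lemma slAut_b : slAut s g (canonical s).b = (canonical s).b := SplitGens.lift_b _

lemma slAut_f : slAut s g (canonical s).f = (canonical s).f := SplitGens.lift_f _

lemma slAut_c : slAut s g (canonical s).c = (canonical s).c := SplitGens.lift_c _

lemma slAut_e : slAut s g (canonical s).e = (canonical s).e := SplitGens.lift_e _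

lemma slAut_phi : slAut s g (canonical s).phi = (canonical s).phi := SplitGens.lift_phi _

lemma diagAut_W : diagAut s u (W s r t) = ((u.1 ^ r * u.2.1 ^ t : kˣ) : k) • W s r t :=
  lift_scale_W s u r t

lemma diagAut_b : diagAut s u (canonical s).b = (u.2.2.1 : k) • (canonical s).b :=
  SplitGens.lift_b _

lemma diagAut_f : diagAut s u (canonical s).f = ((u.2.2.1⁻¹ : kˣ) : k) • (canonical s).f :=
  SplitGens.lift_f _

lemma diagAut_c : diagAut s u (canonical s).c = (u.2.2.2 : k) • (canonical s).c :=
  SplitGens.lift_c _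

lemma diagAut_e : diagAut s u (canonical s).e = ((u.2.2.2⁻¹ : kˣ) : k) • (canonical s).e :=
  SplitGens.lift_e _

lemma diagAut_phi : diagAut s u (canonical s).phi = (canonical s).phi := by
  rw [SplitGens.phi, map_sub, map_one, map_mul, diagAut_b, diagAut_f, smul_mul_smul_comm,
    Units.mul_inv, one_smul]

lemma exists_slAut_mul_diagAut_eq :
    ∃ v, slAut s g * diagAut s u = diagAut s v * slAut s g := by
  have hdet := g.2
  rw [Matrix.det_fin_two] at hdet
  refine ⟨(u.1 ^ g.1 1 1 * u.2.1 ^ (-g.1 1 0), u.1 ^ (-g.1 0 1) * u.2.1 ^ g.1 0 0, u.2.2), ?_⟩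
  refine algEquiv_ext_canonical (fun r t ↦ ?_) ?_ ?_ ?_ ?_
  · simp only [AlgEquiv.mul_apply, diagAut_W, map_smul, slAut_W, mul_zpow, ← zpow_mul]
    rw [mul_mul_mul_comm, ← zpow_add, ← zpow_add]
    congr 4
    · linear_combination (-r) * hdet
    · linear_combination (-t) * hdet
  all_goals simp only [AlgEquiv.mul_apply, diagAut_b, diagAut_f, diagAut_c, diagAut_e, map_smul,
    slAut_b, slAut_f, slAut_c, slAut_e]

lemma exists_diagAut_mul_slAut_eq :
    ∃ v, diagAut s u * slAut s g = slAut s g * diagAut s v := by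
  obtain ⟨v, hv⟩ := exists_slAut_mul_diagAut_eq s g⁻¹ u
  refine ⟨v, ?_⟩
  rw [map_inv, inv_mul_eq_iff_eq_mul, ← mul_assoc, ← div_eq_mul_inv] at hv
  exact mul_eq_of_eq_div hv

variable {s} {r t} in
lemma smul_W_inj {c c' : k} {r' t' : ℤ} (hc : c ≠ 0) (h : c • W s r t = c' • W s r' t') :
    c = c' ∧ r = r' ∧ t = t' := by
  have h_emb : ∀ v, coeff v (c • mono s 0 0 0 0 r t) = coeff v (c' • mono s 0 0 0 0 r' t') :=
    fun v ↦ by rw [← emb_W, ← emb_W, ← map_smul, ← map_smul, h]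
  have hcoeff := h_emb (vec 0 0 0 0 r t)
  rw [map_smul, mono, coeff_single_self, smul_eq_mul, mul_one, map_smul] at hcoeff
  have hvec := eq_of_coeff_single_ne_zero (right_ne_zero_of_smul (hcoeff ▸ hc))
  obtain ⟨-, -, -, -, rfl, rfl⟩ := vec_inj hvec
  rw [mono, coeff_single_self, smul_eq_mul, mul_one] at hcoeff
  exact ⟨hcoeff, rfl, rfl⟩

lemma canonical_b_ne_zero : (canonical s).b ≠ 0 := fun h ↦
  (isMonomial_mono s 0 0 1 0 0 0).hasLead.ne_zero <| by rw [← emb_b, h, map_zero]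

lemma canonical_c_ne_zero : (canonical s).c ≠ 0 := fun h ↦
  (isMonomial_mono s 0 0 0 1 0 0).hasLead.ne_zero <| by rw [← emb_c, h, map_zero]

variable {s} {g} {u} in
lemma slAut_mul_diagAut_inj {g' : SL(2, ℤ)} {u' : Torus k}
    (h : slAut s g * diagAut s u = slAut s g' * diagAut s u') : g = g' ∧ u = u' := by
  have hW : ∀ r t, _ := fun r t ↦ DFunLike.congr_fun h (W s r t)
  have hb := DFunLike.congr_fun h (canonical s).b
  have hc := DFunLike.congr_fun h (canonical s).c
  simp only [AlgEquiv.mul_apply, diagAut_W, map_smul, slAut_W, diagAut_b, slAut_b, diagAut_c,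
    slAut_c] at hW hb hc
  obtain ⟨hα, h00, h10⟩ := smul_W_inj (Units.ne_zero _) (hW 1 0)
  obtain ⟨hβ, h01, h11⟩ := smul_W_inj (Units.ne_zero _) (hW 0 1)
  have hx := smul_left_injective k (canonical_b_ne_zero s) hb
  have hy := smul_left_injective k (canonical_c_ne_zero s) hc
  simp only [zpow_one, zpow_zero, mul_one, one_mul, mul_zero, add_zero, zero_add, Units.val_inj]
    at hα h00 h10 hβ h01 h11 hx hy
  refine ⟨?_, Prod.ext hα (Prod.ext hβ (Prod.ext hx hy))⟩
  ext a b
  fin_cases a <;> fin_cases b <;> assumption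

lemma diagAut_injective : Function.Injective (diagAut s) := fun u v h ↦
  (slAut_mul_diagAut_inj (s := s) (g := 1) (g' := 1) (by rw [h])).2

end Automorphisms

section MapTwoSidedIdeal

variable {R S : Type*} [Ring R] [Ring S] (e : R ≃+* S)

lemma mapTwoSidedIdeal_span_singleton (y : R) :
    e.mapTwoSidedIdeal (TwoSidedIdeal.span {y}) = TwoSidedIdeal.span {e y} := by
  ext z
  rw [RingEquiv.mapTwoSidedIdeal_apply, TwoSidedIdeal.mem_comap]
  exact ⟨fun h ↦ by simpa using map_mem_span_singleton (e : R →+* S) h,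
    fun h ↦ by simpa using map_mem_span_singleton (e.symm : S →+* R) h⟩

variable {e} {I : TwoSidedIdeal R}

lemma IsPrimeIdeal.mapTwoSidedIdeal (hI : IsPrimeIdeal I) :
    IsPrimeIdeal (e.mapTwoSidedIdeal I) := by
  refine ⟨fun h ↦ hI.1 ((map_eq_top_iff e.mapTwoSidedIdeal).1 h), fun x y hxy ↦ ?_⟩
  simp only [RingEquiv.mapTwoSidedIdeal_apply, TwoSidedIdeal.mem_comap] at hxy ⊢
  refine hI.2 _ _ fun r ↦ ?_
  simpa using hxy (e r)

variable (e) in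
/-- The isomorphism of prime spectra induced by an isomorphism of rings. -/
def mapPrimeSpec : PrimeSpec R ≃o PrimeSpec S where
  toEquiv := e.mapTwoSidedIdeal.toEquiv.subtypeEquiv fun I ↦
    ⟨fun h ↦ h.mapTwoSidedIdeal, fun h ↦ by
      rw [← e.mapTwoSidedIdeal.symm_apply_apply I]
      exact h.mapTwoSidedIdeal (e := e.symm)⟩
  map_rel_iff' := e.mapTwoSidedIdeal.map_rel_iff

lemma IsHeightOnePrime.mapTwoSidedIdeal (hI : IsHeightOnePrime I) :
    IsHeightOnePrime (e.mapTwoSidedIdeal I) := by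
  obtain ⟨hP, h⟩ := hI
  exact ⟨hP.mapTwoSidedIdeal, (Order.height_orderIso (mapPrimeSpec e) ⟨I, hP⟩).trans h⟩

end MapTwoSidedIdeal

section NormalElements

lemma exists_eq_mul_of_mem_span_singleton {R : Type*} [Ring R] {y z : R}
    (hy : ∀ r, ∃ r', y * r = r' * y) (hz : z ∈ TwoSidedIdeal.span {y}) : ∃ u, z = u * y := by
  induction hz using TwoSidedIdeal.span_induction with
  | mem z hz => exact ⟨1, by rw [Set.mem_singleton_iff.1 hz, one_mul]⟩
  | zero => exact ⟨0, (zero_mul y).symm⟩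
  | add z z' _ _ hz hz' =>
    obtain ⟨u, rfl⟩ := hz
    obtain ⟨u', rfl⟩ := hz'
    exact ⟨u + u', (add_mul u u' y).symm⟩
  | neg z _ hz =>
    obtain ⟨u, rfl⟩ := hz
    exact ⟨-u, (neg_mul u y).symm⟩
  | left_absorb r z _ hz =>
    obtain ⟨u, rfl⟩ := hz
    exact ⟨r * u, (mul_assoc r u y).symm⟩
  | right_absorb r z _ hz =>
    obtain ⟨u, rfl⟩ := hz
    obtain ⟨r', hr'⟩ := hy r
    exact ⟨u * r', by rw [mul_assoc, hr', mul_assoc]⟩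

end NormalElements

section Rigidity

variable {k : Type*} [Field k] {s : kˣ} [Generic s]

lemma span_map_phi_psi (ρ : D k (s ^ 2) ≃ₐ[k] D k (s ^ 2)) :
    (TwoSidedIdeal.span {ρ (canonical s).phi} = TwoSidedIdeal.span {(canonical s).phi} ∧
      TwoSidedIdeal.span {ρ (canonical s).psi} = TwoSidedIdeal.span {(canonical s).psi}) ∨
    (TwoSidedIdeal.span {ρ (canonical s).phi} = TwoSidedIdeal.span {(canonical s).psi} ∧
      TwoSidedIdeal.span {ρ (canonical s).psi} = TwoSidedIdeal.span {(canonical s).phi}) := by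
  have hprimes := isHeightOnePrime_iff_eq_span s
  simp only [span_phi, span_psi] at hprimes
  have hphi := (hprimes _).1 (((hprimes _).2 (.inl rfl)).mapTwoSidedIdeal (e := ρ.toRingEquiv))
  have hpsi := (hprimes _).1 (((hprimes _).2 (.inr rfl)).mapTwoSidedIdeal (e := ρ.toRingEquiv))
  have hne : ρ.toRingEquiv.mapTwoSidedIdeal (TwoSidedIdeal.span {(canonical s).phi}) ≠
      ρ.toRingEquiv.mapTwoSidedIdeal (TwoSidedIdeal.span {(canonical s).psi}) := fun h ↦
    phi_notMem_span_psi s <| ρ.toRingEquiv.mapTwoSidedIdeal.injective h ▸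
      TwoSidedIdeal.subset_span rfl
  rw [mapTwoSidedIdeal_span_singleton] at hphi hpsi hne
  rw [mapTwoSidedIdeal_span_singleton] at hne
  change TwoSidedIdeal.span {ρ (canonical s).phi} ≠ TwoSidedIdeal.span {ρ (canonical s).psi} at hne
  rcases hphi with hphi | hphi <;> rcases hpsi with hpsi | hpsi
  · exact (hne (hphi.trans hpsi.symm)).elim
  · exact .inl ⟨hphi, hpsi⟩
  · exact .inr ⟨hphi, hpsi⟩
  · exact (hne (hphi.trans hpsi.symm)).elim

lemma exists_eq_smul_W_mul_of_span_eq {y z : D k (s ^ 2)} (hy : ∀ r, ∃ r', y * r = r' * y)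
    (hz : ∀ r, ∃ r', z * r = r' * z) (hz0 : z ≠ 0)
    (h : TwoSidedIdeal.span {y} = TwoSidedIdeal.span {z}) :
    ∃ (c : k) (r t : ℤ), c ≠ 0 ∧ y = c • (W s r t * z) := by
  have := noZeroDivisors_D s
  obtain ⟨u, hu⟩ := exists_eq_mul_of_mem_span_singleton hz
    (h ▸ TwoSidedIdeal.subset_span rfl : y ∈ TwoSidedIdeal.span {z})
  obtain ⟨v, hv⟩ := exists_eq_mul_of_mem_span_singleton hy
    (h ▸ TwoSidedIdeal.subset_span rfl : z ∈ TwoSidedIdeal.span {y})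
  have hvu : v * u = 1 := mul_right_cancel₀ hz0 (by rw [mul_assoc, ← hu, ← hv, one_mul])
  obtain ⟨c, r, t, hc, rfl⟩ := exists_eq_smul_W_of_mul_eq_one (mul_eq_one_comm.1 hvu)
  exact ⟨c, r, t, hc, by rw [hu, smul_mul_assoc]⟩

lemma omega_sub_omega_of_qCommute {y z : D k (s ^ 2)} {N : ℤ} {u v : Lat} (h : QCommute s N y z)
    (hy : coeff v (emb s y) ≠ 0) (hz : IsMonomial (emb s z) u) : omega v u - omega u v = N :=
  Generic.zpow_injective s <| zpow_eq_of_mul_eq_smul_mul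
    (by rw [← map_mul, h, map_smul, map_mul]) hy hz

lemma eq_zero_of_commute_W {y : D k (s ^ 2)} (hy : ∀ r t, Commute y (W s r t))
    {n m i l r t : ℤ} (h : coeff (vec n m i l r t) (emb s y) ≠ 0) : r = 0 ∧ t = 0 := by
  have hK := omega_sub_omega_of_qCommute (qCommute_zero.2 (hy 1 0)) h
    (emb_W s 1 0 ▸ isMonomial_mono ..)
  have ha := omega_sub_omega_of_qCommute (qCommute_zero.2 (hy 0 1)) h
    (emb_W s 0 1 ▸ isMonomial_mono ..)
  rw [omega_vec, omega_vec] at hK ha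
  lia

end Rigidity

namespace SplitGens

variable {k : Type*} [Field k] {s : kˣ} {B B' : Type*} [Ring B] [Algebra k B] [Ring B']
  [Algebra k B'] (d : SplitGens s B) (f : B →ₐ[k] B')

/-- The images of split generators under a homomorphism. -/
def map : SplitGens s B' where
  w r t := f (d.w r t)
  b := f d.b
  f := f d.f
  c := f d.c
  e := f d.e
  w_zero := by rw [d.w_zero, map_one]
  w_mul r t r' t' := by rw [← map_mul, d.w_mul, map_smul]
  b_w r t := (d.b_w r t).map f
  f_w r t := (d.f_w r t).map f
  c_w r t := (d.c_w r t).map f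
  e_w r t := (d.e_w r t).map f
  f_b := by simp only [← map_mul, d.f_b, map_add, map_smul, map_one]
  e_c := by simp only [← map_mul, d.e_c, map_add, map_smul, map_one]
  b_c := d.b_c.map f
  f_c := d.f_c.map f
  b_e := d.b_e.map f
  f_e := d.f_e.map f

lemma map_phi : (d.map f).phi = f d.phi := by simp [phi, map]

lemma map_psi : (d.map f).psi = f d.psi := by simp [psi, map]

end SplitGens

section Bihomogeneous

variable {k : Type*} [Field k] {s : kˣ} [Generic s]

/-- `y` commutes with the torus and is homogeneous for the bigrading of `D_q` in which `b`, `f`,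
`c`, `e` have the bidegrees `(1, 0)`, `(-1, 0)`, `(0, 1)`, `(0, -1)`. Since `s` is not a root of
unity, the bidegree is determined by the commutation with `φ` and `ψ`. -/
structure IsBihomogeneous (y : D k (s ^ 2)) (i l : ℤ) : Prop where
  commute_W : ∀ r t, Commute y (W s r t)
  qCommute_phi : QCommute s (4 * i) y (canonical s).phi
  qCommute_psi : QCommute s (-4 * l) y (canonical s).psi

namespace IsBihomogeneous

variable {x y z : D k (s ^ 2)} {i l : ℤ}

lemma eq_of_coeff_ne_zero (hy : IsBihomogeneous y i l) {n m i' l' r t : ℤ}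
    (h : coeff (vec n m i' l' r t) (emb s y) ≠ 0) : i' = i ∧ l' = l ∧ r = 0 ∧ t = 0 := by
  have hphi := omega_sub_omega_of_qCommute hy.qCommute_phi h (emb_phi s ▸ isMonomial_mono ..)
  have hpsi := omega_sub_omega_of_qCommute hy.qCommute_psi h (emb_psi s ▸ isMonomial_mono ..)
  rw [omega_vec, omega_vec] at hphi hpsi
  have hrt := eq_zero_of_commute_W hy.commute_W h
  lia

lemma exists_hasLead (hy : IsBihomogeneous y i l) (hy0 : y ≠ 0) :
    ∃ n m : ℤ, HasLead (emb s y) (vec n m i l 0 0) ∧ 0 ≤ n ∧ -i ≤ n ∧ 0 ≤ m ∧ -l ≤ m := by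
  obtain ⟨⟨n, m, i', l', r, t⟩, hlead⟩ := exists_hasLead_emb hy0
  obtain ⟨rfl, rfl, rfl, rfl⟩ := hy.eq_of_coeff_ne_zero hlead.1
  exact ⟨_, _, hlead, by lia, by lia, by lia, by lia⟩

lemma exists_eq_smul_of_hasLead_mul (hy : IsBihomogeneous y i l)
    (hz : IsBihomogeneous z (-i) (-l)) (hyz : HasLead (emb s (y * z)) (vec i l 0 0 0 0))
    (hx : IsMonomial (emb s x) (vec 0 0 i l 0 0)) : ∃ a : k, a ≠ 0 ∧ y = a • x := by
  have hyz0 : y * z ≠ 0 := fun h ↦ hyz.ne_zero (by rw [h, map_zero])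
  obtain ⟨n, m, hlead, hn, -, hm, -⟩ := hy.exists_hasLead (left_ne_zero_of_mul hyz0)
  obtain ⟨n', m', hlead', -, hn', -, hm'⟩ := hz.exists_hasLead (right_ne_zero_of_mul hyz0)
  rw [map_mul] at hyz
  have hsum := hyz.unique (hlead.mul hlead')
  rw [vec_add] at hsum
  obtain ⟨hi, hl, -⟩ := vec_inj hsum
  obtain rfl : n = 0 := by lia
  obtain rfl : m = 0 := by lia
  refine exists_eq_smul_of_emb_isMonomial ⟨_, hlead.1, eq_single_of_forall_coeff fun v hv ↦ ?_⟩ hx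
  obtain ⟨n, m, i', l', r, t, rfl⟩ := exists_vec v
  obtain ⟨rfl, rfl, rfl, rfl⟩ := hy.eq_of_coeff_ne_zero hv
  obtain ⟨hn0, hm0⟩ := nonneg_of_coeff_emb_ne_zero hv
  have hle := hlead.2 _ hv
  obtain rfl : n = 0 := hn0.antisymm' (not_lt.1 fun h ↦ hle.not_gt (vec_lt_of_fst_lt h))
  obtain rfl : m = 0 := hm0.antisymm' (not_lt.1 fun h ↦ hle.not_gt (vec_lt_of_snd_lt h))
  rfl

end IsBihomogeneous

end Bihomogeneous

section FixingTorus

variable {k : Type*} [Field k] {s : kˣ} [Generic s]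

lemma phi_pos : 0 < vec 1 0 0 0 0 0 := vec_zero ▸ vec_lt_of_fst_lt one_pos

lemma psi_pos : 0 < vec 0 1 0 0 0 0 := vec_zero ▸ vec_lt_of_snd_lt one_pos

lemma hasLead_emb_one_sub_smul {p : D k (s ^ 2)} {v : Lat} (hp : IsMonomial (emb s p) v)
    (hv : 0 < v) {c : k} (hc : c ≠ 0) : HasLead (emb s (1 - c • p)) v := by
  have h : emb s (1 - c • p) = -c • emb s p + 1 := by
    rw [map_sub, map_one, map_smul, neg_smul]
    abel
  rw [h]
  exact (hp.smul (neg_ne_zero.2 hc)).hasLead.add_of_lt isMonomial_one.hasLead hv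

lemma mul_ne_one_of_emb_isMonomial {x : D k (s ^ 2)} {n m i l r t : ℤ}
    (hx : IsMonomial (emb s x) (vec n m i l r t)) (hil : i ≠ 0 ∨ l ≠ 0) (y : D k (s ^ 2)) :
    x * y ≠ 1 := fun h ↦ by
  obtain ⟨c, r', t', hc, rfl⟩ := exists_eq_smul_W_of_mul_eq_one h
  rw [map_smul, emb_W] at hx
  have heq := hx.hasLead.unique ((isMonomial_mono s ..).smul hc).hasLead
  obtain ⟨-, -, rfl, rfl, -⟩ := vec_inj heq
  simp at hil

/-- If `x f = 1 - p` and `x z = 1 - c p`, then `p (1 - c)` is a multiple of `x`; were `c ≠ 1`, so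
would be `1 = x f + p`. -/
lemma eq_one_of_mul_eq_one_sub {A : Type*} [Ring A] [Algebra k A] {x f z p : A} {c : k}
    (hx : ∀ y, x * y ≠ 1) (hf : x * f = 1 - p) (hz : x * z = 1 - c • p) : c = 1 := by
  by_contra hc
  refine hx (f + (1 - c)⁻¹ • (z - f)) ?_
  have hsub : x * (z - f) = (1 - c) • p := by
    rw [mul_sub, hz, hf]
    module
  rw [mul_add, mul_smul_comm, hsub, inv_smul_smul₀ (sub_ne_zero.2 (Ne.symm hc)), hf,
    sub_add_cancel]

lemma exists_eq_smul_of_mul_eq_one_sub {x f y z p : D k (s ^ 2)} {i l : ℤ}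
    (hil : i ≠ 0 ∨ l ≠ 0) (hpos : 0 < vec i l 0 0 0 0)
    (hx : IsMonomial (emb s x) (vec 0 0 i l 0 0)) (hp : IsMonomial (emb s p) (vec i l 0 0 0 0))
    (hf : x * f = 1 - p) {c : k} (hc : c ≠ 0) (hyz : y * z = 1 - c • p)
    (hy : IsBihomogeneous y i l) (hz : IsBihomogeneous z (-i) (-l)) :
    ∃ a : kˣ, y = (a : k) • x ∧ z = ((a⁻¹ : kˣ) : k) • f := by
  have := noZeroDivisors_D s
  obtain ⟨a, ha, rfl⟩ := hy.exists_eq_smul_of_hasLead_mul hz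
    (hyz ▸ hasLead_emb_one_sub_smul hp hpos hc) hx
  refine ⟨Units.mk0 a ha, rfl, ?_⟩
  rw [smul_mul_assoc, ← mul_smul_comm] at hyz
  have hx_unit := mul_ne_one_of_emb_isMonomial hx hil
  have hx0 : x ≠ 0 := fun h ↦ hx.hasLead.ne_zero (by rw [h, map_zero])
  rw [eq_one_of_mul_eq_one_sub hx_unit hf hyz, one_smul, ← hf] at hyz
  rw [← mul_left_cancel₀ hx0 hyz, smul_smul, Units.val_inv_eq_inv_val, Units.val_mk0,
    inv_mul_cancel₀ ha, one_smul]

lemma exists_eq_smul_of_span_eq {y z : D k (s ^ 2)} (hy : ∀ r, ∃ r', y * r = r' * y)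
    (hz : ∀ r, ∃ r', z * r = r' * z) (hyW : ∀ r t, Commute y (W s r t)) {n m : ℤ}
    (hz_emb : emb s z = mono s n m 0 0 0 0)
    (h : TwoSidedIdeal.span {y} = TwoSidedIdeal.span {z}) : ∃ c : k, c ≠ 0 ∧ y = c • z := by
  have hz0 : z ≠ 0 := by
    rintro rfl
    exact (isMonomial_mono s n m 0 0 0 0).hasLead.ne_zero (hz_emb ▸ map_zero _)
  obtain ⟨c, r, t, hc, rfl⟩ := exists_eq_smul_W_mul_of_span_eq hy hz hz0 h
  have hlead : HasLead (emb s (c • (W s r t * z))) (vec n m 0 0 r t) := by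
    rw [map_smul, map_mul, emb_W, hz_emb]
    have h := ((isMonomial_mono s 0 0 0 0 r t).mul (isMonomial_mono s n m 0 0 0 0)).smul hc
    simpa only [vec_add, zero_add, add_zero] using h.hasLead
  obtain ⟨rfl, rfl⟩ := eq_zero_of_commute_W hyW hlead.1
  exact ⟨c, hc, by rw [W_zero, one_mul]⟩

variable {ρ : D k (s ^ 2) ≃ₐ[k] D k (s ^ 2)}

omit [Generic s] in
lemma exists_map_mul_eq {y : D k (s ^ 2)} (hy : ∀ r, ∃ r', y * r = r' * y) (r : D k (s ^ 2)) :
    ∃ r', ρ y * r = r' * ρ y := by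
  obtain ⟨r', hr'⟩ := hy (ρ.symm r)
  exact ⟨ρ r', by rw [← map_mul, ← hr', map_mul, ρ.apply_symm_apply]⟩

omit [Generic s] in
lemma commute_map_W (hρ : ∀ r t, ρ (W s r t) = W s r t) {y : D k (s ^ 2)}
    (hy : ∀ r t, Commute y (W s r t)) (r t : ℤ) : Commute (ρ y) (W s r t) :=
  hρ r t ▸ (hy r t).map ρ

lemma exists_map_phi_psi_eq_smul (hρ : ∀ r t, ρ (W s r t) = W s r t) :
    ∃ c c' : k, c ≠ 0 ∧ c' ≠ 0 ∧
      (ρ (canonical s).phi = c • (canonical s).phi ∧ ρ (canonical s).psi = c' • (canonical s).psi ∨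
        ρ (canonical s).phi = c • (canonical s).psi ∧
          ρ (canonical s).psi = c' • (canonical s).phi) := by
  have hphi := commute_map_W hρ (canonical s).commute_phi_w
  have hpsi := commute_map_W hρ (canonical s).commute_psi_w
  have normal_phi := exists_phi_mul_eq s
  have normal_psi := exists_psi_mul_eq s
  have normal_map_phi := exists_map_mul_eq (ρ := ρ) normal_phi
  have normal_map_psi := exists_map_mul_eq (ρ := ρ) normal_psi
  rcases span_map_phi_psi ρ with ⟨h, h'⟩ | ⟨h, h'⟩
  · obtain ⟨c, hc, h⟩ := exists_eq_smul_of_span_eq normal_map_phi normal_phi hphi (emb_phi s) h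
    obtain ⟨c', hc', h'⟩ := exists_eq_smul_of_span_eq normal_map_psi normal_psi hpsi (emb_psi s) h'
    exact ⟨c, c', hc, hc', .inl ⟨h, h'⟩⟩
  · obtain ⟨c, hc, h⟩ := exists_eq_smul_of_span_eq normal_map_phi normal_psi hphi (emb_psi s) h
    obtain ⟨c', hc', h'⟩ := exists_eq_smul_of_span_eq normal_map_psi normal_phi hpsi (emb_phi s) h'
    exact ⟨c, c', hc, hc', .inr ⟨h, h'⟩⟩

lemma map_phi_ne_smul_psi (hρ : ∀ r t, ρ (W s r t) = W s r t) {c c' : k} (hc : c ≠ 0)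
    (hc' : c' ≠ 0) (h : ρ (canonical s).phi = c • (canonical s).psi) :
    ρ (canonical s).psi ≠ c' • (canonical s).phi := fun h' ↦ by
  let d := (canonical s).map (ρ : D k (s ^ 2) →ₐ[k] D k (s ^ 2))
  have d_phi : d.phi = c • (canonical s).psi := (SplitGens.map_phi _ _).trans h
  have d_psi : d.psi = c' • (canonical s).phi := (SplitGens.map_psi _ _).trans h'
  have bihom_f : IsBihomogeneous d.f 0 1 := by
    refine ⟨commute_map_W hρ (canonical s).f_w, ?_, ?_⟩
    · exact .of_smul_right hc' (d_psi ▸ qCommute_zero.2 d.commute_psi_f.symm)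
    · exact .of_smul_right hc (d_phi ▸ d.qCommute_f_phi)
  have bihom_e : IsBihomogeneous d.e 1 0 := by
    refine ⟨commute_map_W hρ (canonical s).e_w, ?_, ?_⟩
    · exact .of_smul_right hc' (d_psi ▸ d.qCommute_e_psi)
    · exact .of_smul_right hc (d_phi ▸ qCommute_zero.2 d.commute_phi_e.symm)
  have hf0 : d.f ≠ 0 := fun h0 ↦ by
    have hlead := hasLead_emb_one_sub_smul (emb_psi s ▸ isMonomial_mono ..) psi_pos hc
    rw [← d_phi, ← d.b_mul_f, h0, mul_zero, map_zero] at hlead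
    exact hlead.ne_zero rfl
  have he0 : d.e ≠ 0 := fun h0 ↦ by
    have hlead := hasLead_emb_one_sub_smul (emb_phi s ▸ isMonomial_mono ..) phi_pos hc'
    rw [← d_psi, ← d.c_mul_e, h0, mul_zero, map_zero] at hlead
    exact hlead.ne_zero rfl
  obtain ⟨n, m, hlead_f, hn, -⟩ := bihom_f.exists_hasLead hf0
  obtain ⟨n', m', hlead_e, -, -, hm', -⟩ := bihom_e.exists_hasLead he0
  have f_e : emb s d.f * emb s d.e = (s : k) ^ (4 : ℤ) • (emb s d.e * emb s d.f) :=
    d.f_e.map (emb s)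
  have hweight := Generic.zpow_injective s (hlead_f.zpow_eq_of_mul_eq_smul_mul hlead_e f_e)
  rw [omega_vec, omega_vec] at hweight
  lia

theorem exists_eq_diagAut (hρ : ∀ r t, ρ (W s r t) = W s r t) : ∃ u, ρ = diagAut s u := by
  obtain ⟨c, c', hc, hc', ⟨h, h'⟩ | ⟨h, h'⟩⟩ := exists_map_phi_psi_eq_smul hρ
  swap
  · exact (map_phi_ne_smul_psi hρ hc hc' h h').elim
  let d := (canonical s).map (ρ : D k (s ^ 2) →ₐ[k] D k (s ^ 2))
  have d_phi : d.phi = c • (canonical s).phi := (SplitGens.map_phi _ _).trans h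
  have d_psi : d.psi = c' • (canonical s).psi := (SplitGens.map_psi _ _).trans h'
  have bihom_b : IsBihomogeneous d.b 1 0 := ⟨commute_map_W hρ (canonical s).b_w,
    .of_smul_right hc (d_phi ▸ d.qCommute_b_phi),
    .of_smul_right hc' (d_psi ▸ qCommute_zero.2 d.commute_psi_b.symm)⟩
  have bihom_f : IsBihomogeneous d.f (-1) (-0) := ⟨commute_map_W hρ (canonical s).f_w,
    .of_smul_right hc (d_phi ▸ d.qCommute_f_phi),
    .of_smul_right hc' (d_psi ▸ qCommute_zero.2 d.commute_psi_f.symm)⟩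
  have bihom_c : IsBihomogeneous d.c 0 1 := ⟨commute_map_W hρ (canonical s).c_w,
    .of_smul_right hc (d_phi ▸ qCommute_zero.2 d.commute_phi_c.symm),
    .of_smul_right hc' (d_psi ▸ d.qCommute_c_psi)⟩
  have bihom_e : IsBihomogeneous d.e (-0) (-1) := ⟨commute_map_W hρ (canonical s).e_w,
    .of_smul_right hc (d_phi ▸ qCommute_zero.2 d.commute_phi_e.symm),
    .of_smul_right hc' (d_psi ▸ d.qCommute_e_psi)⟩
  obtain ⟨a, map_b, map_f⟩ := exists_eq_smul_of_mul_eq_one_sub (.inl one_ne_zero) phi_pos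
    (emb_b s ▸ isMonomial_mono ..) (emb_phi s ▸ isMonomial_mono ..) (canonical s).b_mul_f hc
    (d_phi ▸ d.b_mul_f) bihom_b bihom_f
  obtain ⟨a', map_c, map_e⟩ := exists_eq_smul_of_mul_eq_one_sub (.inr one_ne_zero) psi_pos
    (emb_c s ▸ isMonomial_mono ..) (emb_psi s ▸ isMonomial_mono ..) (canonical s).c_mul_e hc'
    (d_psi ▸ d.c_mul_e) bihom_c bihom_e
  refine ⟨(1, 1, a, a'), algEquiv_ext_canonical (fun r t ↦ ?_) ?_ ?_ ?_ ?_⟩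
  · simp [hρ, diagAut_W]
  · exact map_b.trans (diagAut_b s (1, 1, a, a')).symm
  · exact map_f.trans (diagAut_f s (1, 1, a, a')).symm
  · exact map_c.trans (diagAut_c s (1, 1, a, a')).symm
  · exact map_e.trans (diagAut_e s (1, 1, a, a')).symm

omit ρ in
lemma det_eq_one_of_qCommute_smul_W {c c' : k} {i j m n : ℤ} (hc : c ≠ 0) (hc' : c' ≠ 0)
    (h : QCommute s 2 (c' • W s m n) (c • W s i j)) : i * n - m * j = 1 := by
  have isMonomial_emb {c : k} (hc : c ≠ 0) (r t : ℤ) :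
      IsMonomial (emb s (c • W s r t)) (vec 0 0 0 0 r t) := by
    rw [map_smul, emb_W]
    exact (isMonomial_mono s ..).smul hc
  have hweight := omega_sub_omega_of_qCommute h (isMonomial_emb hc' m n).hasLead.1
    (isMonomial_emb hc i j)
  rw [omega_vec, omega_vec] at hweight
  linarith

lemma exists_map_W_eq_smul (ρ : D k (s ^ 2) ≃ₐ[k] D k (s ^ 2)) (r t : ℤ) :
    ∃ (c : k) (r' t' : ℤ), c ≠ 0 ∧ ρ (W s r t) = c • W s r' t' := by
  refine exists_eq_smul_W_of_mul_eq_one (v := ρ (W s (-r) (-t))) ?_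
  rw [← map_mul]
  exact (congrArg ρ ((canonical s).w_mul_w_neg r t)).trans (map_one ρ)

theorem exists_eq_slAut_mul_diagAut (ρ : D k (s ^ 2) ≃ₐ[k] D k (s ^ 2)) :
    ∃ g u, ρ = slAut s g * diagAut s u := by
  obtain ⟨α, i, j, hα, map_K⟩ := exists_map_W_eq_smul ρ 1 0
  obtain ⟨β, m, n, hβ, map_a⟩ := exists_map_W_eq_smul ρ 0 1
  have hdet : i * n - m * j = 1 := by
    have a_K : QCommute s 2 (W s 0 1) (W s 1 0) := qCommute_W 0 1 1 0
    have map_a_K := a_K.map (ρ : D k (s ^ 2) →ₐ[k] D k (s ^ 2))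
    change QCommute s 2 (ρ (W s 0 1)) (ρ (W s 1 0)) at map_a_K
    rw [map_K, map_a] at map_a_K
    exact det_eq_one_of_qCommute_smul_W hα hβ map_a_K
  let g : SL(2, ℤ) := ⟨!![i, m; j, n], by rwa [Matrix.det_fin_two_of]⟩
  let u : Torus k := (Units.mk0 α hα, Units.mk0 β hβ, 1, 1)
  let τ : D k (s ^ 2) ≃ₐ[k] D k (s ^ 2) := slAut s g * diagAut s u
  have τ_K : τ (W s 1 0) = ρ (W s 1 0) := by
    rw [map_K, AlgEquiv.mul_apply, diagAut_W, map_smul, slAut_W]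
    simp [g, u]
  have τ_a : τ (W s 0 1) = ρ (W s 0 1) := by
    rw [map_a, AlgEquiv.mul_apply, diagAut_W, map_smul, slAut_W]
    simp [g, u]
  have hfix : ∀ r t, (τ⁻¹ * ρ) (W s r t) = W s r t := by
    refine (canonical s).map_W_of (f := ((τ⁻¹ * ρ : D k (s ^ 2) ≃ₐ[k] D k (s ^ 2)) :
      D k (s ^ 2) →ₐ[k] D k (s ^ 2))) ?_ ?_
    · rw [x_K]
      exact τ.symm_apply_eq.2 τ_K.symm
    · rw [x_a]
      exact τ.symm_apply_eq.2 τ_a.symm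
  obtain ⟨v, hv⟩ := exists_eq_diagAut hfix
  refine ⟨g, u * v, ?_⟩
  rw [map_mul, ← mul_assoc, ← hv]
  exact (mul_inv_cancel_left τ ρ).symm

end FixingTorus

section SemidirectProduct

variable {N G H : Type*} [Group N] [Group G] [Group H]

lemma exists_semidirectProduct_mulEquiv_of_bijective (f : N →* H) (φ : G →* H) [f.range.Normal]
    (hbij : Function.Bijective fun p : N × G ↦ f p.1 * φ p.2) :
    ∃ (θ : G →* MulAut N) (e : N ⋊[θ] G ≃* H), ∀ y, e y = f y.left * φ y.right := by
  have f_inj : Function.Injective f := fun n n' h ↦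
    congrArg Prod.fst (hbij.1 (a₁ := (n, 1)) (a₂ := (n', 1)) (congrArg (· * φ 1) h))
  have φ_inj : Function.Injective φ := fun g g' h ↦
    congrArg Prod.snd (hbij.1 (a₁ := (1, g)) (a₂ := (1, g')) (congrArg (f 1 * ·) h))
  let eN := MonoidHom.ofInjective f_inj
  let eG := MonoidHom.ofInjective φ_inj
  have compl : f.range.IsComplement' φ.range :=
    ((eN.toEquiv.prodCongr eG.toEquiv).bijective.of_comp_iff _).1 hbij
  exact ⟨_, (SemidirectProduct.congr' eN.symm eG.symm).symm.trans
    (SemidirectProduct.mulEquivSubgroup compl), fun _ ↦ rfl⟩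

end SemidirectProduct

section Parameters

variable {k : Type*} [Field k]

/-- The parameters `(λ, μ, γ, ν)` of the diagonal automorphism `diagAut s u`. -/
def rhoParam : Torus k →* Torus k where
  toFun u := (u.1, u.2.1, u.1⁻¹ * u.2.1 ^ 2 * u.2.2.1⁻¹, u.2.1⁻¹ ^ 2 * u.2.2.2⁻¹)
  map_one' := by simp
  map_mul' u v := by
    simp only [Prod.fst_mul, Prod.snd_mul, Prod.mk_mul_mk, mul_inv, mul_pow]
    simp only [mul_assoc, mul_left_comm]

lemma rhoParam_rhoParam (u : Torus k) : rhoParam (rhoParam u) = u := by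
  ext <;> simp only [rhoParam, MonoidHom.coe_mk, OneHom.coe_mk] <;> push_cast <;> field_simp

/-- The discrepancy between the parameters `(λ, μ, γ, ν)` of `slAut s g * diagAut s u` and those of
`diagAut s u`. It is caused by the difference between the monomials `K^r a^t` and their symmetrized
forms `W s r t`. -/
def rhoShift (s : kˣ) (g : SL(2, ℤ)) : Torus k :=
  let i := g.1 0 0
  let j := g.1 1 0
  let m := g.1 0 1
  let n := g.1 1 1
  (s ^ (i * j), s ^ (m * n), s ^ ((2 * m - i) * (2 * n - j) + 2 * (2 * n - j) - 2), s ^ (4 * m * n))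

lemma rhoShift_one (s : kˣ) : rhoShift s 1 = 1 := by
  simp [rhoShift]

end Parameters

section Rho

variable {k : Type*} [Field k] {s : kˣ}

local notation "𝔻" => D k (s ^ 2)
local notation "X" => x k (s ^ 2)

lemma IsRho.unique {ρ τ : 𝔻 ≃ₐ[k] 𝔻} {t : Torus k} {M : SL(2, ℤ)} (hρ : IsRho ρ t M)
    (hτ : IsRho τ t M) : ρ = τ := by
  obtain ⟨ρ_K, ρ_a, ρ_F, ρ_b, ρ_E, ρ_c⟩ := hρ
  obtain ⟨τ_K, τ_a, τ_F, τ_b, τ_E, τ_c⟩ := hτ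
  have eq_on_inv (u : 𝔻ˣ) (hu : ρ u = τ u) : ρ (u⁻¹ : 𝔻ˣ) = τ (u⁻¹ : 𝔻ˣ) := by
    have map_eq : Units.map (ρ : 𝔻 →* 𝔻) u = Units.map (τ : 𝔻 →* 𝔻) u := Units.ext hu
    exact congrArg Units.val (congrArg (·⁻¹) map_eq)
  refine AlgEquiv.coe_toAlgHom_injective (AlgHom.ext_of_adjoin_eq_top adjoin_range_x ?_)
  rintro _ ⟨g, rfl⟩
  cases g
  · exact ρ_a.trans τ_a.symm
  · exact eq_on_inv (aUnit k (s ^ 2)) (ρ_a.trans τ_a.symm)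
  · exact ρ_b.trans τ_b.symm
  · exact ρ_c.trans τ_c.symm
  · exact ρ_K.trans τ_K.symm
  · exact eq_on_inv (KUnit k (s ^ 2)) (ρ_K.trans τ_K.symm)
  · exact ρ_E.trans τ_E.symm
  · exact ρ_F.trans τ_F.symm

lemma W_eq_smul_KA (r t : ℤ) : W s r t = ((s ^ (r * t) : kˣ) : k) • KA k (s ^ 2) r t := by
  rw [W, Units.val_zpow_eq_zpow_val]

lemma W_add_eq_smul_KA_mul_W (i j r t : ℤ) : W s (i + r) (j + t) =
    ((s ^ (i * j + i * t - j * r) : kˣ) : k) • (KA k (s ^ 2) i j * W s r t) := by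
  have W_eq : W s (i + r) (j + t) = (s : k) ^ (i * t - j * r) • (W s i j * W s r t) := by
    rw [W_mul, smul_smul, ← zpow_add₀ s.ne_zero, sub_add_sub_cancel, sub_self, zpow_zero, one_smul]
  rw [W_eq, W_eq_smul_KA i j, smul_mul_assoc, smul_smul, Units.val_zpow_eq_zpow_val,
    Units.val_zpow_eq_zpow_val, ← zpow_add₀ s.ne_zero, add_comm, add_sub_assoc]

variable [Generic s] (g : SL(2, ℤ)) (u : Torus k)

lemma slAut_mul_diagAut_W (r t : ℤ) : (slAut s g * diagAut s u) (W s r t) =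
    ((u.1 ^ r * u.2.1 ^ t : kˣ) : k) •
      W s (g.1 0 0 * r + g.1 0 1 * t) (g.1 1 0 * r + g.1 1 1 * t) := by
  rw [AlgEquiv.mul_apply, diagAut_W, map_smul, slAut_W]

variable {g u} in
lemma slAut_mul_diagAut_W_mul {r t i j : ℤ} {z : 𝔻} {ζ v : kˣ}
    (hi : g.1 0 0 * r + g.1 0 1 * t = i + r) (hj : g.1 1 0 * r + g.1 1 1 * t = j + t)
    (hz : slAut s g z = z) (hζ : diagAut s u z = (ζ : k) • z)
    (hv : u.1 ^ r * u.2.1 ^ t * ζ * s ^ (i * j + i * t - j * r) = v) :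
    (slAut s g * diagAut s u) (W s r t * z) = (v : k) • (KA k (s ^ 2) i j * (W s r t * z)) := by
  rw [map_mul, slAut_mul_diagAut_W, hi, hj, AlgEquiv.mul_apply, hζ, map_smul, hz,
    W_add_eq_smul_KA_mul_W, smul_smul, smul_mul_smul_comm, ← Units.val_mul, ← Units.val_mul,
    mul_assoc (KA _ _ _ _), mul_right_comm _ (s ^ _) ζ, hv]

lemma slAut_mul_diagAut_x_K : (slAut s g * diagAut s u) (X .K) =
    ((rhoParam u * rhoShift s g).1 : k) • KA k (s ^ 2) (g.1 0 0) (g.1 1 0) := by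
  rw [x_K, slAut_mul_diagAut_W, W_eq_smul_KA, smul_smul, ← Units.val_mul]
  simp [rhoParam, rhoShift]

lemma slAut_mul_diagAut_x_a : (slAut s g * diagAut s u) (X .a) =
    ((rhoParam u * rhoShift s g).2.1 : k) • KA k (s ^ 2) (g.1 0 1) (g.1 1 1) := by
  rw [x_a, slAut_mul_diagAut_W, W_eq_smul_KA, smul_smul, ← Units.val_mul]
  simp [rhoParam, rhoShift]

lemma slAut_mul_diagAut_x_F : (slAut s g * diagAut s u) (X .F) =
    ((rhoParam u * rhoShift s g).2.2.1 : k) •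
      (KA k (s ^ 2) (-g.1 0 0 + 2 * g.1 0 1 + 1) (-g.1 1 0 + 2 * g.1 1 1 - 2) * X .F) := by
  have param_eq : u.1 ^ (-1 : ℤ) * u.2.1 ^ (2 : ℤ) * u.2.2.1⁻¹ = (rhoParam u).2.2.1 := by
    simp [rhoParam]
  rw [x_F, ← mul_smul_comm]
  refine slAut_mul_diagAut_W_mul (by ring) (by ring) ?_ ?_
    (congrArg₂ (· * ·) param_eq (congrArg (s ^ ·) ?_))
  · rw [map_smul, slAut_f]
  · rw [map_smul, diagAut_f, smul_comm]
  · ring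

lemma slAut_mul_diagAut_x_E : (slAut s g * diagAut s u) (X .E) =
    ((rhoParam u * rhoShift s g).2.2.2 : k) •
      (KA k (s ^ 2) (-2 * g.1 0 1) (-2 * g.1 1 1 + 2) * X .E) := by
  have param_eq : u.1 ^ (0 : ℤ) * u.2.1 ^ (-2 : ℤ) * u.2.2.2⁻¹ = (rhoParam u).2.2.2 := by
    simp [rhoParam, zpow_neg]
  rw [x_E, ← mul_smul_comm]
  refine slAut_mul_diagAut_W_mul (by ring) (by ring) ?_ ?_
    (congrArg₂ (· * ·) param_eq (congrArg (s ^ ·) ?_))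
  · rw [map_smul, slAut_e]
  · rw [map_smul, diagAut_e, smul_comm]
  · ring

lemma slAut_mul_diagAut_x_b : (slAut s g * diagAut s u) (X .b) =
    (((rhoParam u * rhoShift s g).2.1 * (rhoParam u * rhoShift s g).2.2.1⁻¹ *
      (s ^ 2) ^ (g.1 0 0 * g.1 1 0 + 2 * g.1 0 1 * g.1 1 1 - 3 * g.1 0 0 * g.1 1 1 - 2 * g.1 1 0 +
        3 * g.1 1 1) : kˣ) : k) •
      (KA k (s ^ 2) (g.1 0 0 - g.1 0 1 - 1) (g.1 1 0 - g.1 1 1 + 1) * X .b) := by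
  have hdet := g.2
  rw [Matrix.det_fin_two] at hdet
  have param_eq : u.1 ^ (1 : ℤ) * u.2.1 ^ (-1 : ℤ) * u.2.2.1 =
      (rhoParam u).2.1 * (rhoParam u).2.2.1⁻¹ := by
    ext
    simp only [rhoParam, MonoidHom.coe_mk, OneHom.coe_mk]
    push_cast
    field_simp
  rw [x_b]
  refine slAut_mul_diagAut_W_mul (by ring) (by ring) (slAut_b s g) (diagAut_b s u) ?_
  rw [param_eq, Prod.snd_mul, Prod.snd_mul, Prod.fst_mul, Prod.fst_mul, mul_inv,
    mul_mul_mul_comm, mul_assoc _ (_ * _)]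
  congr 1
  simp only [rhoShift, ← zpow_neg, ← zpow_natCast, ← zpow_mul, ← zpow_add]
  congr 1
  push_cast
  linear_combination 3 * hdet

lemma slAut_mul_diagAut_x_c : (slAut s g * diagAut s u) (X .c) =
    (((rhoParam u * rhoShift s g).1 * (rhoParam u * rhoShift s g).2.1⁻¹ *
      (rhoParam u * rhoShift s g).2.2.2⁻¹ *
      (s ^ 2) ^ (g.1 0 0 * g.1 1 1 + 3 * g.1 0 1 * g.1 1 1 - g.1 1 0 - g.1 1 1) : kˣ) : k) •
      (KA k (s ^ 2) (g.1 0 0 + g.1 0 1 - 1) (g.1 1 0 + g.1 1 1 - 1) * X .c) := by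
  have hdet := g.2
  rw [Matrix.det_fin_two] at hdet
  have param_eq : u.1 ^ (1 : ℤ) * u.2.1 ^ (1 : ℤ) * u.2.2.2 =
      (rhoParam u).1 * (rhoParam u).2.1⁻¹ * (rhoParam u).2.2.2⁻¹ := by
    ext
    simp only [rhoParam, MonoidHom.coe_mk, OneHom.coe_mk]
    push_cast
    field_simp
  rw [x_c]
  refine slAut_mul_diagAut_W_mul (by ring) (by ring) (slAut_c s g) (diagAut_c s u) ?_
  rw [param_eq, Prod.snd_mul, Prod.snd_mul, Prod.snd_mul, Prod.fst_mul, Prod.fst_mul, mul_inv,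
    mul_inv, mul_mul_mul_comm _ (rhoShift s g).1, mul_mul_mul_comm _ (_ * _), mul_assoc _ (_ * _)]
  congr 1
  simp only [rhoShift, ← zpow_neg, ← zpow_natCast, ← zpow_mul, ← zpow_add]
  congr 1
  push_cast
  linear_combination -hdet

lemma isRho_slAut_mul_diagAut :
    IsRho (slAut s g * diagAut s u) (rhoParam u * rhoShift s g) g.transpose :=
  ⟨slAut_mul_diagAut_x_K g u, slAut_mul_diagAut_x_a g u, slAut_mul_diagAut_x_F g u,
    slAut_mul_diagAut_x_b g u, slAut_mul_diagAut_x_E g u, slAut_mul_diagAut_x_c g u⟩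

lemma isRho_slAut_mul_diagAut_of_param (t : Torus k) (M : SL(2, ℤ)) :
    IsRho (slAut s M.transpose * diagAut s (rhoParam (t * (rhoShift s M.transpose)⁻¹))) t M := by
  have hρ := isRho_slAut_mul_diagAut (s := s) M.transpose
    (rhoParam (t * (rhoShift s M.transpose)⁻¹))
  rwa [rhoParam_rhoParam, inv_mul_cancel_right] at hρ

theorem existsUnique_isRho (t : Torus k) (M : SL(2, ℤ)) : ∃! ρ : 𝔻 ≃ₐ[k] 𝔻, IsRho ρ t M :=
  ⟨_, isRho_slAut_mul_diagAut_of_param t M,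
    fun _ h ↦ h.unique (isRho_slAut_mul_diagAut_of_param t M)⟩

theorem existsUnique_param_isRho (ρ : 𝔻 ≃ₐ[k] 𝔻) :
    ∃! p : Torus k × SL(2, ℤ), IsRho ρ p.1 p.2 := by
  obtain ⟨g, u, rfl⟩ := exists_eq_slAut_mul_diagAut ρ
  refine ⟨(rhoParam u * rhoShift s g, g.transpose), isRho_slAut_mul_diagAut g u, ?_⟩
  rintro ⟨t, M⟩ ht
  obtain ⟨rfl, rfl⟩ := slAut_mul_diagAut_inj (ht.unique (isRho_slAut_mul_diagAut_of_param t M))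
  rw [rhoParam_rhoParam, inv_mul_cancel_right]
  rfl

variable (s)

/-- The automorphisms `ρ_{t,1}`, where `1` is the identity matrix. -/
noncomputable def torusAut : Torus k →* (𝔻 ≃ₐ[k] 𝔻) := (diagAut s).comp rhoParam

lemma diagAut_eq_torusAut : diagAut s u = torusAut s (rhoParam u) :=
  (congrArg (diagAut s) (rhoParam_rhoParam u)).symm

lemma torusAut_injective : Function.Injective (torusAut (k := k) s) :=
  (diagAut_injective s).comp (Function.LeftInverse.injective rhoParam_rhoParam)

lemma isRho_torusAut (t : Torus k) : IsRho (torusAut s t) t 1 := by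
  have hρ := isRho_slAut_mul_diagAut (s := s) 1 (rhoParam t)
  rwa [map_one, one_mul, rhoParam_rhoParam, rhoShift_one, mul_one,
    show Matrix.SpecialLinearGroup.transpose (1 : SL(2, ℤ)) = 1 from
      Subtype.ext Matrix.transpose_one] at hρ

instance normal_range_torusAut : (torusAut (k := k) s).range.Normal where
  conj_mem := by
    rintro _ ⟨t, rfl⟩ ρ
    obtain ⟨g, u, rfl⟩ := exists_eq_slAut_mul_diagAut ρ
    obtain ⟨v, hv⟩ := exists_slAut_mul_diagAut_eq s g (rhoParam t)
    refine ⟨rhoParam v, ?_⟩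
    have comm : Commute (diagAut s (rhoParam t)) (diagAut s u) := (Commute.all _ u).map (diagAut s)
    rw [← diagAut_eq_torusAut, eq_mul_inv_iff_mul_eq, ← mul_assoc, ← hv, mul_assoc, mul_assoc]
    exact congrArg (slAut s g * ·) comm.eq

lemma bijective_torusAut_mul_slAut :
    Function.Bijective fun p : Torus k × SL(2, ℤ) ↦ torusAut s p.1 * slAut s p.2 := by
  refine ⟨?_, fun ρ ↦ ?_⟩
  · rintro ⟨t, g⟩ ⟨t', g'⟩ (h : torusAut s t * slAut s g = torusAut s t' * slAut s g')
    obtain ⟨v, hv⟩ := exists_diagAut_mul_slAut_eq s g (rhoParam t)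
    obtain ⟨v', hv'⟩ := exists_diagAut_mul_slAut_eq s g' (rhoParam t')
    obtain ⟨rfl, -⟩ := slAut_mul_diagAut_inj (hv.symm.trans (h.trans hv'))
    rw [torusAut_injective s (mul_right_cancel h)]
  · obtain ⟨g, u, rfl⟩ := exists_eq_slAut_mul_diagAut ρ
    obtain ⟨v, hv⟩ := exists_slAut_mul_diagAut_eq s g u
    exact ⟨(rhoParam v, g), by rw [hv, diagAut_eq_torusAut]⟩

theorem exists_semidirectProduct_mulEquiv_isRho :
    ∃ (θ : SL(2, ℤ) →* MulAut (Torus k)) (e : Torus k ⋊[θ] SL(2, ℤ) ≃* (𝔻 ≃ₐ[k] 𝔻)),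
      (∀ t : Torus k, IsRho (e (SemidirectProduct.inl t)) t 1) ∧
      ∀ y, ∃ t : Torus k, IsRho (e y) t y.right.transpose := by
  obtain ⟨θ, e, he⟩ := exists_semidirectProduct_mulEquiv_of_bijective (torusAut (k := k) s)
    (slAut s) (bijective_torusAut_mul_slAut s)
  refine ⟨θ, e, fun t ↦ ?_, fun y ↦ ?_⟩
  · rw [he, SemidirectProduct.left_inl, SemidirectProduct.right_inl, map_one, mul_one]
    exact isRho_torusAut s t
  · obtain ⟨v, hv⟩ := exists_diagAut_mul_slAut_eq s y.right (rhoParam y.left)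
    exact ⟨_, (he y).trans hv ▸ isRho_slAut_mul_diagAut y.right v⟩

variable {s}

theorem map_span_phi_ne_span_psi (ρ : 𝔻 ≃ₐ[k] 𝔻) :
    (TwoSidedIdeal.span {phi k (s ^ 2)}).map ρ ≠ TwoSidedIdeal.span {psi k (s ^ 2)} := by
  rw [span_phi, span_psi]
  intro h
  obtain ⟨g, u, rfl⟩ := exists_eq_slAut_mul_diagAut ρ
  refine phi_notMem_span_psi s (h ▸ TwoSidedIdeal.subset_span ?_)
  exact ⟨(canonical s).phi, TwoSidedIdeal.subset_span rfl,
    (congrArg (slAut s g) (diagAut_phi s u)).trans (slAut_phi s g)⟩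

end Rho

lemma generic_of_sq_pow_ne_one {k : Type*} [Field k] {s : kˣ}
    (hs : ∀ n : ℕ, 0 < n → (s ^ 2) ^ n ≠ 1) : Generic s := by
  refine ⟨fun n hn ↦ ?_⟩
  by_contra hne
  have zpow_eq : s ^ n = 1 := Units.ext (by rw [Units.val_zpow_eq_zpow_val, hn, Units.val_one])
  refine hs n.natAbs (Int.natAbs_pos.2 hne) ?_
  rw [pow_right_comm, pow_natAbs_eq_one.2 zpow_eq, one_pow]

lemma isSquare_units_of_isAlgClosed {k : Type*} [Field k] [IsAlgClosed k] (q : kˣ) :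
    IsSquare q := by
  obtain ⟨z, hz⟩ := IsAlgClosed.exists_pow_nat_eq (q : k) two_pos
  have hz_unit : IsUnit z := (isUnit_pow_iff two_ne_zero).1 (hz ▸ q.isUnit)
  exact (isSquare_iff_exists_sq q).2 ⟨hz_unit.unit, Units.ext hz.symm⟩

end HeisenbergDouble

open HeisenbergDouble in
theorem mainTheorem3_general (k : Type*) [Field k] (q : kˣ) (hsq : IsSquare q)
    (hq : ∀ n : ℕ, 0 < n → q ^ n ≠ 1) :
    (∀ (t : Torus k) (M : SL(2, ℤ)), ∃! ρ : D k q ≃ₐ[k] D k q, IsRho ρ t M) ∧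
    (∀ ρ : D k q ≃ₐ[k] D k q, ∃! p : Torus k × SL(2, ℤ), IsRho ρ p.1 p.2) ∧
    (∃ (θ : SL(2, ℤ) →* MulAut (Torus k))
      (e : Torus k ⋊[θ] SL(2, ℤ) ≃* (D k q ≃ₐ[k] D k q)),
        (∀ t : Torus k, IsRho (e (SemidirectProduct.inl t)) t 1) ∧
        ∀ y, ∃ t : Torus k, IsRho (e y) t y.right.transpose) ∧
    (∀ P : TwoSidedIdeal (D k q), IsHeightOnePrime P ↔
      P = TwoSidedIdeal.span {phi k q} ∨ P = TwoSidedIdeal.span {psi k q}) ∧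
    (∀ ρ : D k q ≃ₐ[k] D k q,
      ¬ ((TwoSidedIdeal.span {phi k q}).map ρ = TwoSidedIdeal.span {psi k q} ∧
        (TwoSidedIdeal.span {psi k q}).map ρ = TwoSidedIdeal.span {phi k q})) := by
  obtain ⟨s, rfl⟩ := (isSquare_iff_exists_sq q).1 hsq
  have : Generic s := generic_of_sq_pow_ne_one hq
  exact ⟨existsUnique_isRho, existsUnique_param_isRho, exists_semidirectProduct_mulEquiv_isRho s,
    isHeightOnePrime_iff_eq_span s, fun ρ h ↦ map_span_phi_ne_span_psi ρ h.1⟩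

open HeisenbergDouble in
theorem mainTheorem3 (k : Type*) [Field k] [IsAlgClosed k] [CharZero k] (q : kˣ)
    (hq : ∀ n : ℕ, 0 < n → q ^ n ≠ 1) :
    -- each family of parameters defines an automorphism
    (∀ (t : Torus k) (M : SL(2, ℤ)), ∃! ρ : D k q ≃ₐ[k] D k q, IsRho ρ t M) ∧
    -- each automorphism is of this form, for exactly one family of parameters
    (∀ ρ : D k q ≃ₐ[k] D k q, ∃! p : Torus k × SL(2, ℤ), IsRho ρ p.1 p.2) ∧
    -- `Aut D_q ≅ (k*)⁴ ⋊ SL₂(ℤ)`, with `(k*)⁴` and `SL₂(ℤ)` placed as the parameters tell;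
    -- the transpose appears because `IsRho` records the images of `K` and `a` as rows
    (∃ (θ : SL(2, ℤ) →* MulAut (Torus k))
      (e : Torus k ⋊[θ] SL(2, ℤ) ≃* (D k q ≃ₐ[k] D k q)),
        (∀ t : Torus k, IsRho (e (SemidirectProduct.inl t)) t 1) ∧
        ∀ y, ∃ t : Torus k, IsRho (e y) t y.right.transpose) ∧
    -- the height one primes are `(φ)` and `(ψ)`, and no automorphism interchanges them
    (∀ P : TwoSidedIdeal (D k q), IsHeightOnePrime P ↔
      P = TwoSidedIdeal.span {phi k q} ∨ P = TwoSidedIdeal.span {psi k q}) ∧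
    (∀ ρ : D k q ≃ₐ[k] D k q,
      ¬ ((TwoSidedIdeal.span {phi k q}).map ρ = TwoSidedIdeal.span {psi k q} ∧
        (TwoSidedIdeal.span {psi k q}).map ρ = TwoSidedIdeal.span {phi k q})) :=
  mainTheorem3_general k q (isSquare_units_of_isAlgClosed q) hq
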